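/- Notation. $\kappa\in\mathbb N$ is the security parameter. A function $f(\kappa)$ is negligible if $f=O(\kappa^{-c})$ for every $c>0$, and polynomial if $f=O(\kappa^{c})$ for some $c>0$. $D_{\mathbb Z,\sigma}$ ($\sigma>0$) is the discrete Gaussian on $\mathbb Z$ with mass proportional to $e^{-\pi x^2/\sigma^2}$; for $A\in\mathbb Z_q^{n\times m}$, $A_\sigma^{-1}(y)$ is the law of $x\leftarrow D_{\mathbb Z,\sigma}^m$ conditioned on $Ax=y \bmod q$ (the point mass at $0$ if there is no solution). Put $m=n\lceil\log_2 q\rceil$, let $G=I_n\otimes(1,2,\dots,2^{\lceil\log_2 q\rceil-1})\in\mathbb Z_q^{n\times m}$, and let $G^{-1}(v)\in\{0,1\}^m$ be the vector of binary digits of the entries of $v\in\mathbb Z_q^n$. Let $\chi_0(n,q)=\sqrt{n\log q}\cdot\omega(\sqrt{\log n})$, i.e. $\chi_0(n,q)\ge\sqrt{n\log q}\,f(n)$ for all $n$ and all $q>2$, for some $f$ with $f(n)/\sqrt{\log n}\to\infty$. Let $(\mathsf{TrapGen},\mathsf{SamplePre})$ be a pair of randomized trapdoor sampling algorithms for $\chi_0$: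 for all sufficiently large $n$ and all primes $q>2$, if $(A,\mathsf{td})\leftarrow\mathsf{TrapGen}(1^n,1^m,q)$, then $A\in\mathbb Z_q^{n\times m}$ is within statistical distance $2^{-n}$ of uniform, and for all $\sigma\ge\chi_0(n,q)$, $\sigma>0$, and all $y\in\mathbb Z_q^n$, the laws of $(A,\mathsf{td},x)$ for $x\leftarrow\mathsf{SamplePre}(A,\mathsf{td},y,\sigma)$ and for $x\leftarrow A_\sigma^{-1}(y)$ are within statistical distance $2^{-n}$. Scheme. Let $n,q,m',\chi,\chi'$ be functions of $\kappa$. Authorities and users are identified by elements of $\{0,1\}^\kappa$. - $\mathsf{GlobalSetup}$ chooses a random oracle $H$ on pairs $(\mathsf{gid},v)\in\{0,1\}^\kappa\times\mathbb Z_q^n$ with independent values distributed as $D_{\mathbb Z,\chi'}^{m'}$ modulo $q$. - $\mathsf{AuthSetup}$ for an authority $a$ draws $(A_a,\mathsf{td}_a)\leftarrow\mathsf{TrapGen}(1^n,1^m,q)$ and uniform $B_a\in\mathbb Z_q^{n\times m'}$, $P_a\in\mathbb Z_q^{n\times m}$; the public key is $(A_a,B_a,P_a)$ and the master secret key is $\mathsf{td}_a$.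 - $\mathsf{Keygen}$ for $(\mathsf{gid},v)$ outputs $k_a\leftarrow\mathsf{SamplePre}(A_a,\mathsf{td}_a,P_aG^{-1}(v)+B_aH(\mathsf{gid},v),\chi)$. - $\mathsf{Enc}$ of $u\in\mathbb Z_q^n$ for a set $X$ of authorities draws uniform $s_a\in\mathbb Z_q^n$, $e_{1,a}\leftarrow D_{\mathbb Z,\chi}^m$ ($a\in X$), $e_2\leftarrow D_{\mathbb Z,\chi}^{m'}$, $e_3\leftarrow D_{\mathbb Z,\chi}^m$ and outputs $c_{1,a}^\top=s_a^\top A_a+e_{1,a}^\top$ ($a\in X$), $c_2^\top=\sum_{a\in X}s_a^\top B_a+e_2^\top$, $c_3^\top=\sum_{a\in X}s_a^\top P_a+e_3^\top+u^\top G$. - $\mathsf{Dec}$, given keys $k_a$ for the authorities $a$ of a set $Y\supseteq X$, outputs $\Gamma=c_3^\top G^{-1}(v)+c_2^\top H(\mathsf{gid},v)-\sum_{a\in X}c_{1,a}^\top k_a\in\mathbb Z_q$ (and $\bot$ if $X\not\subseteq Y$). Theorem. Suppose that $q(\kappa)>2$ is prime, $\chi(\kappa),\chi'(\kappa)>0$,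 that $m=n\lceil\log_2q\rceil$, $m'$ and $\ell$ are polynomial in $\kappa$, that $2^{-n(\kappa)}$ is negligible, and that $\chi(\kappa)\ge\chi_0(n(\kappa),q(\kappa))$ for all $\kappa$. Put $$B_0=\sqrt{\kappa}\,\chi m+\kappa\,\chi\chi' m'+\kappa\,\chi^2 m\,\ell .$$ Then the scheme, as a $(B_0,B_1)$-MA-ABNIPFE for subset policies (for any $B_1$, which does not enter correctness), is approximately correct for ciphertexts under at most $\ell(\kappa)$ authorities: there is a negligible function $\mathrm{negl}$ such that for all $\kappa$, all $u,v\in\mathbb Z_q^n$, every user $\mathsf{gid}$, every set $X$ of at most $\ell(\kappa)$ authorities and every authorized set $Y\supseteq X$, if one runs $\mathsf{GlobalSetup}$, $\mathsf{AuthSetup}$ and then $\mathsf{Keygen}$ for $(\mathsf{gid},v)$ for all authorities of $Y$, encrypts $u$ for $X$ and decrypts with the keys of $Y$, then $$\Pr\bigl[\Gamma=u^\top v+e_0\ \text{ for some integer } e_0\in[-B_0(\kappa),B_0(\kappa)]\bigr]\ \ge\ 1-\mathrm{negl}(\kappa).$$ -/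

import Mathlib

open Filter Asymptotics

open scoped Matrix ENNReal

namespace MAABNIPFE

/-! ### Asymptotic notions -/

/-- A function of the security parameter is negligible if it is `O(κ ^ (-c))` for every `c > 0`. -/
def Negligible (f : ℕ → ℝ) : Prop :=
  ∀ c : ℝ, 0 < c → f =O[atTop] fun κ : ℕ => (κ : ℝ) ^ (-c)

/-- A function of the security parameter is polynomial if it is `O(κ ^ c)` for some `c > 0`. -/
def PolyBounded (f : ℕ → ℝ) : Prop :=
  ∃ c : ℝ, 0 < c ∧ f =O[atTop] fun κ : ℕ => (κ : ℝ) ^ c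

/-- `χ₀(n, q) = √(n log q) · ω(√(log n))`: the factor in front of `√(n log q)` dominates some
`f(n)` with `f(n) / √(log n) → ∞`. -/
def IsWidthThreshold (χ₀ : ℕ → ℕ → ℝ) : Prop :=
  ∃ f : ℕ → ℝ, Tendsto (fun n : ℕ => f n / √(Real.log n)) atTop atTop ∧
    ∀ n q : ℕ, 2 < q → √(n * Real.logb 2 q) * f n ≤ χ₀ n q

/-! ### Distributions -/

/-- Statistical distance of two discrete distributions. -/
noncomputable def statDist {α : Type*} (p p' : PMF α) : ℝ :=
  (1 / 2) * ∑' a, |(p a).toReal - (p' a).toReal|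

theorem tsum_prod_fin {α : Type*} (k : ℕ) (p : Fin k → α → ℝ≥0∞) :
    ∑' f : Fin k → α, ∏ i, p i (f i) = ∏ i, ∑' a, p i a := by
  induction k with
  | zero => simp [tsum_fintype]
  | succ k ih =>
    rw [← (Fin.consEquiv fun _ : Fin (k + 1) => α).tsum_eq, ENNReal.tsum_prod', Fin.prod_univ_succ,
      ← ENNReal.tsum_mul_right]
    refine tsum_congr fun a => ?_
    simp [Fin.prod_univ_succ, Fin.consEquiv, ENNReal.tsum_mul_left, ih fun i => p i.succ]

theorem tsum_prod_fintype {ι α : Type*} [Fintype ι] (p : ι → PMF α) :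
    ∑' f : ι → α, ∏ i, p i (f i) = 1 := by
  rw [← ((Fintype.equivFin ι).arrowCongr (Equiv.refl α)).symm.tsum_eq]
  calc _ = ∑' f : Fin (Fintype.card ι) → α, ∏ j, p ((Fintype.equivFin ι).symm j) (f j) := by
        refine tsum_congr fun f => ?_
        rw [← (Fintype.equivFin ι).symm.prod_comp]
        simp [Equiv.arrowCongr]
    _ = 1 := by
        rw [tsum_prod_fin _ fun j a => p ((Fintype.equivFin ι).symm j) a]
        simp [PMF.tsum_coe]

/-- The law of a finite family of independent samples, the `i`-th one from `p i`. -/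
noncomputable def indep {ι α : Type*} [Fintype ι] (p : ι → PMF α) : PMF (ι → α) :=
  ⟨fun f => ∏ i, p i (f i), ENNReal.summable.hasSum_iff.2 (tsum_prod_fintype p)⟩

/-- The Gaussian weight `exp(-π x² / σ²)`. -/
noncomputable def gaussWeight (σ : ℝ) (x : ℤ) : ℝ≥0∞ :=
  ENNReal.ofReal (Real.exp (-Real.pi * (x : ℝ) ^ 2 / σ ^ 2))

theorem gaussWeight_tsum_ne_zero (σ : ℝ) : ∑' x, gaussWeight σ x ≠ 0 := by
  rw [Ne, ENNReal.tsum_eq_zero, not_forall]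
  exact ⟨0, by simp [gaussWeight]⟩

theorem gaussWeight_tsum_ne_top {σ : ℝ} (hσ : 0 < σ) : ∑' x, gaussWeight σ x ≠ ∞ := by
  have h := summable_pow_mul_jacobiTheta₂_term_bound 0 (T := 1 / σ ^ 2) (by positivity) 0
  have h' : Summable fun x : ℤ => Real.exp (-Real.pi * (x : ℝ) ^ 2 / σ ^ 2) := by
    refine h.congr fun x => ?_
    simp only [pow_zero, one_mul]
    congr 1
    ring
  exact h'.tsum_ofReal_ne_top

/-- The centred discrete Gaussian `D_{ℤ,σ}` of width `σ > 0`: mass proportional to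
`exp(-π x² / σ²)`. (For `σ ≤ 0` the value is irrelevant.) -/
noncomputable def discreteGaussian (σ : ℝ) : PMF ℤ :=
  if hσ : 0 < σ then
    PMF.normalize (gaussWeight σ) (gaussWeight_tsum_ne_zero σ) (gaussWeight_tsum_ne_top hσ)
  else PMF.pure 0

/-- `D_{ℤ,σ}^ι`: a vector with independent discrete Gaussian entries. -/
noncomputable def gaussianVec (ι : Type*) [Fintype ι] (σ : ℝ) : PMF (ι → ℤ) :=
  indep fun _ => discreteGaussian σ

/-- Entrywise reduction modulo `q`. -/
def modVec {ι : Type*} (q : ℕ) (x : ι → ℤ) : ι → ZMod q := fun i => (x i : ZMod q)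

open Classical in
/-- `A_σ⁻¹(y)`: a vector `x ← D_{ℤ,σ}^ι` conditioned on `A x = y mod q`. (If the conditioning event
has probability zero, the value is irrelevant.) -/
noncomputable def gaussianPreimage {n q : ℕ} {ι : Type*} [Fintype ι]
    (A : Matrix (Fin n) ι (ZMod q)) (y : Fin n → ZMod q) (σ : ℝ) : PMF (ι → ℤ) :=
  if h : ∃ x ∈ {x : ι → ℤ | A *ᵥ modVec q x = y}, x ∈ (gaussianVec ι σ).support then
    (gaussianVec ι σ).filter {x | A *ᵥ modVec q x = y} h
  else PMF.pure 0

/-! ### The gadget matrix -/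

/-- Column indices `(i, b)` of the gadget matrix; there are `m = n ⌈log₂ q⌉` of them. -/
abbrev GIdx (n q : ℕ) : Type := Fin n × Fin (Nat.clog 2 q)

/-- `G = Iₙ ⊗ (1, 2, …, 2 ^ (⌈log₂ q⌉ - 1))`. -/
def gadget (n q : ℕ) : Matrix (Fin n) (GIdx n q) (ZMod q) :=
  fun i p => if i = p.1 then 2 ^ (p.2 : ℕ) else 0

/-- `G⁻¹(v)`: the vector of the binary digits of the entries of `v`. -/
def gadgetInv {n q : ℕ} (v : Fin n → ZMod q) : GIdx n q → ZMod q :=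
  fun p => if (v p.1).val.testBit p.2 then 1 else 0

/-! ### Trapdoor sampling -/

/-- A pair of randomized algorithms `(TrapGen, SamplePre)` with lattice trapdoors in `TD n q`, used
with `m = n ⌈log₂ q⌉` columns. -/
structure TrapdoorSampler where
  TD : ℕ → ℕ → Type
  trapGen : (n q : ℕ) → PMF (Matrix (Fin n) (GIdx n q) (ZMod q) × TD n q)
  samplePre : {n q : ℕ} → Matrix (Fin n) (GIdx n q) (ZMod q) → TD n q → (Fin n → ZMod q) → ℝ →
    PMF (GIdx n q → ℤ)

/-- `(TrapGen, SamplePre)` implements trapdoor sampling for widths `σ ≥ χ₀(n, q)`, for prime moduli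
`q > 2` and all sufficiently large `n`: the matrix from `TrapGen` is `2⁻ⁿ`-close to uniform, and for every target `y`, given
`(A, td) ← TrapGen`, the output of `SamplePre(A, td, y, σ)` is `2⁻ⁿ`-close to `A_σ⁻¹(y)`. -/
def TrapdoorSampler.Implements (T : TrapdoorSampler) (χ₀ : ℕ → ℕ → ℝ) : Prop :=
  ∃ N : ℕ, ∀ (n q : ℕ) [Fact q.Prime], N ≤ n → 2 < q →
    statDist ((T.trapGen n q).map Prod.fst)
      (PMF.uniformOfFintype (Matrix (Fin n) (GIdx n q) (ZMod q))) ≤ 2⁻¹ ^ n ∧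
    ∀ σ : ℝ, 0 < σ → χ₀ n q ≤ σ → ∀ y : Fin n → ZMod q,
      statDist
        ((T.trapGen n q).bind fun a => (T.samplePre a.1 a.2 y σ).map fun x => (a, x))
        ((T.trapGen n q).bind fun a => (gaussianPreimage a.1 y σ).map fun x => (a, x)) ≤ 2⁻¹ ^ n

/-- The exact sampler: a uniform matrix, and preimages drawn exactly from `A_σ⁻¹(y)`. -/
noncomputable def exactSampler : TrapdoorSampler where
  TD _ _ := Unit
  trapGen n q := if h : q = 0 then PMF.pure (0, ()) else
    haveI : NeZero q := ⟨h⟩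
    (PMF.uniformOfFintype (Matrix (Fin n) (GIdx n q) (ZMod q))).map fun A => (A, ())
  samplePre A _ y σ := gaussianPreimage A y σ

/-- `Implements` is satisfiable, for every threshold. -/
theorem exactSampler_implements (χ₀ : ℕ → ℕ → ℝ) : exactSampler.Implements χ₀ := by
  refine ⟨0, fun n q hq _ _ => ⟨?_, fun σ _ _ y => ?_⟩⟩
  · have h0 : q ≠ 0 := hq.out.ne_zero
    simp only [exactSampler, h0, dite_false, PMF.map_comp]
    have : (Prod.fst ∘ fun A : Matrix (Fin n) (GIdx n q) (ZMod q) => (A, ())) = id := rfl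
    rw [this, PMF.map_id]
    simp [statDist]
  · simp [exactSampler, statDist]

/-! ### Multi-authority attribute-based noisy inner-product functional encryption -/

/-- A multi-authority attribute-based noisy inner-product functional encryption scheme over `ℤ_q^n`
for subset policies, at one value of the security parameter, with authority universe `AU` and user
universe `GID`. A policy is given by the set `A` of authorities of the ciphertext. -/
structure Scheme (n q : ℕ) (AU GID : Type) where
  GP : Type
  PK : Type
  MSK : Type
  SK : Type
  CT : Type
  globalSetup : PMF GP
  authSetup : GP → AU → PMF (PK × MSK)
  keygen : GP → PK → MSK → GID → (Fin n → ZMod q) → PMF SK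
  enc : GP → (A : Finset AU) → (A → PK) → (Fin n → ZMod q) → PMF CT
  dec : GP → (B : Finset AU) → (B → SK) → GID → (Fin n → ZMod q) → CT → PMF (Option (ZMod q))

/-- The access structure of the subset policy of `A`: the authorized sets are those containing
`A`. -/
def subsetPolicy {AU : Type} (A : Finset AU) : Set (Finset AU) := {B | A ⊆ B}

/-- The output of decryption in the correctness experiment: set up the authorities, issue keys for
`(gid, v)` by the authorities in `B`, encrypt `u` under the policy of `A`, decrypt with the keys. -/
noncomputable def Scheme.experiment {n q : ℕ} {AU GID : Type} (S : Scheme n q AU GID)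
    (u v : Fin n → ZMod q) (gid : GID) (A B : Finset AU) (hB : B ∈ subsetPolicy A) :
    PMF (Option (ZMod q)) :=
  S.globalSetup.bind fun gp =>
  (indep fun aid : B => S.authSetup gp aid).bind fun keys =>
  (indep fun aid : B => S.keygen gp (keys aid).1 (keys aid).2 gid v).bind fun sk =>
  (S.enc gp A (fun aid => (keys ⟨aid, hB aid.2⟩).1) u).bind fun ct =>
  S.dec gp B sk gid v ct

/-- Approximate correctness with noise bound `B₀(κ)`, for ciphertexts under at most `ℓ(κ)`
authorities: up to a negligible probability, decryption with the keys of an authorized set returns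
`uᵀ v + e₀` for some integer `e₀ ∈ [-B₀(κ), B₀(κ)]`. -/
def ApproxCorrect {n q : ℕ → ℕ} {AU GID : ℕ → Type}
    (S : (κ : ℕ) → Scheme (n κ) (q κ) (AU κ) (GID κ)) (ℓ : ℕ → ℕ) (B₀ : ℕ → ℝ) : Prop :=
  ∃ negl : ℕ → ℝ, Negligible negl ∧
    ∀ (κ : ℕ) (u v : Fin (n κ) → ZMod (q κ)) (gid : GID κ) (A : Finset (AU κ)), A.card ≤ ℓ κ →
      ∀ (B : Finset (AU κ)) (hB : B ∈ subsetPolicy A),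
        1 - negl κ ≤ (((S κ).experiment u v gid A B hB).toOuterMeasure
          {Γ | ∃ e₀ : ℤ, |(e₀ : ℝ)| ≤ B₀ κ ∧ Γ = some (u ⬝ᵥ v + (e₀ : ZMod (q κ)))}).toReal

/-! ### The construction -/

/-- A public key `(A, B, P)`. -/
structure PubKey (n q m' : ℕ) where
  A : Matrix (Fin n) (GIdx n q) (ZMod q)
  B : Matrix (Fin n) (Fin m') (ZMod q)
  P : Matrix (Fin n) (GIdx n q) (ZMod q)

/-- A ciphertext `({c₁,aid} for aid ∈ auths, c₂, c₃)`. -/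
structure Ciphertext (n q m' : ℕ) (AU : Type) where
  auths : Finset AU
  c₁ : auths → GIdx n q → ZMod q
  c₂ : Fin m' → ZMod q
  c₃ : GIdx n q → ZMod q

/-- The scheme, in the random oracle model: the global parameters hold the random oracle `H`, whose
values are independent and distributed as `D_{ℤ,χ'}^{m'}` modulo `q`. -/
noncomputable def construction (T : TrapdoorSampler) (n q m' : ℕ) [NeZero q] (χ χ' : ℝ)
    (AU GID : Type) [DecidableEq AU] [Fintype GID] : Scheme n q AU GID where
  GP := GID × (Fin n → ZMod q) → Fin m' → ZMod q
  PK := PubKey n q m'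
  MSK := T.TD n q
  SK := GIdx n q → ℤ
  CT := Ciphertext n q m' AU
  globalSetup := indep fun _ => (gaussianVec (Fin m') χ').map (modVec q)
  authSetup _ _ :=
    (T.trapGen n q).bind fun a =>
    (PMF.uniformOfFintype (Matrix (Fin n) (Fin m') (ZMod q))).bind fun B =>
    (PMF.uniformOfFintype (Matrix (Fin n) (GIdx n q) (ZMod q))).map fun P =>
    (⟨a.1, B, P⟩, a.2)
  keygen H pk td gid v :=
    T.samplePre pk.A td (pk.P *ᵥ gadgetInv v + pk.B *ᵥ H (gid, v)) χ
  enc _ A pk u :=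
    (indep fun _ : A => PMF.uniformOfFintype (Fin n → ZMod q)).bind fun s =>
    (indep fun _ : A => gaussianVec (GIdx n q) χ).bind fun e₁ =>
    (gaussianVec (Fin m') χ).bind fun e₂ =>
    (gaussianVec (GIdx n q) χ).map fun e₃ =>
    { auths := A
      c₁ := fun aid => s aid ᵥ* (pk aid).A + modVec q (e₁ aid)
      c₂ := ∑ aid, s aid ᵥ* (pk aid).B + modVec q e₂
      c₃ := ∑ aid, s aid ᵥ* (pk aid).P + modVec q e₃ + u ᵥ* gadget n q }
  dec H B sk gid v ct := PMF.pure <|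
    if h : ct.auths ⊆ B then
      some (ct.c₃ ⬝ᵥ gadgetInv v + ct.c₂ ⬝ᵥ H (gid, v)
        - ∑ aid : ct.auths, ct.c₁ aid ⬝ᵥ modVec q (sk ⟨aid, h aid.2⟩))
    else none

end MAABNIPFE

namespace MAABNIPFE

/-! ### Probabilities of events -/

/-! If every key satisfies `A k = P G⁻¹(v) + B H`, the terms with `s` cancel in decryption, and `G
G⁻¹(v) = v` leaves `uᵀv` plus the error `e₃ᵀG⁻¹(v) + e₂ᵀH - Σ e₁ᵀk`. This error is within `B₀` once
all errors, the keys and the oracle value have entries at most `√κ` times their widths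
(`exists_decryption_error`). For the errors and the oracle value this is a Gaussian tail bound
(`discreteGaussian_tail`).

The substance lies in the keys. A Gaussian conditioned on `A x = y` need not be short for every `A`,
and `A x = y` may have no solution, so one argues on average over a uniform `A` by second moments.
If `z`, `z'` are not proportional, `(A z, A z')` is uniform. Hence the Gaussian mass of `{A x = y}`
concentrates around `q⁻ⁿ`, provided every residue vector has mass at most `δ` with `qⁿ⁺¹ δ` small
(`sum_fiberMass_sub_sq_le`). With `n⌈log₂ q⌉` coordinates it suffices that one Gaussian entry hits
each residue with probability at most `2/5`, a constant below `1/2`. This holds for large widths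
(`discreteGaussian_residue_le`), and `χ₀` is eventually as large as needed.
`gaussianPreimage_toOuterMeasure_le` converts concentration into a failure bound, and
`TrapdoorSampler.toOuterMeasure_samplePre_le` carries it over to the actual sampler.

A union bound over the authorities of the ciphertext gives a polynomial times a negligible function;
`n` tends to infinity because `2⁻ⁿ` is negligible. -/

theorem tsum_prod_fintype_ennreal {ι α : Type*} [Fintype ι] (p : ι → α → ℝ≥0∞) :
    ∑' f : ι → α, ∏ i, p i (f i) = ∏ i, ∑' a, p i a := by
  rw [← ((Fintype.equivFin ι).arrowCongr (Equiv.refl α)).symm.tsum_eq]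
  calc _ = ∑' f : Fin (Fintype.card ι) → α, ∏ j, p ((Fintype.equivFin ι).symm j) (f j) := by
        refine tsum_congr fun f => ?_
        rw [← (Fintype.equivFin ι).symm.prod_comp]
        simp [Equiv.arrowCongr]
    _ = _ := by
        rw [tsum_prod_fin _ fun j a => p ((Fintype.equivFin ι).symm j) a]
        exact (Fintype.equivFin ι).symm.prod_comp fun i => ∑' a, p i a

theorem toOuterMeasure_indep {ι α : Type*} [Fintype ι] (p : ι → PMF α) (S : ι → Set α) :
    (indep p).toOuterMeasure {f | ∀ i, f i ∈ S i} = ∏ i, (p i).toOuterMeasure (S i) := by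
  classical
  simp only [PMF.toOuterMeasure_apply]
  rw [← tsum_prod_fintype_ennreal fun i => (S i).indicator (p i)]
  refine tsum_congr fun f => ?_
  by_cases hf : ∀ i, f i ∈ S i
  · rw [Set.indicator_of_mem (by exact hf)]
    exact Finset.prod_congr rfl fun i _ => (Set.indicator_of_mem (hf i) _).symm
  · rw [Set.indicator_of_notMem (by exact hf)]
    obtain ⟨i, hi⟩ := not_forall.1 hf
    exact (Finset.prod_eq_zero (Finset.mem_univ i) (Set.indicator_of_notMem hi _)).symm

theorem toOuterMeasure_univ {α : Type*} (p : PMF α) : p.toOuterMeasure Set.univ = 1 := by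
  simp [PMF.toOuterMeasure_apply, PMF.tsum_coe]

theorem toOuterMeasure_le_one {α : Type*} (p : PMF α) (E : Set α) : p.toOuterMeasure E ≤ 1 :=
  (p.toOuterMeasure.mono (Set.subset_univ E)).trans_eq (toOuterMeasure_univ p)

theorem toOuterMeasure_indep_eval {ι α : Type*} [Fintype ι] (p : ι → PMF α) (i : ι) (S : Set α) :
    (indep p).toOuterMeasure {f | f i ∈ S} = (p i).toOuterMeasure S := by
  classical
  have h : {f : ι → α | f i ∈ S} = {f | ∀ j, f j ∈ if j = i then S else Set.univ} := by
    ext f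
    refine ⟨fun hf j => ?_, fun hf => by simpa using hf i⟩
    split_ifs with hj
    · exact hj ▸ hf
    · trivial
  rw [h, toOuterMeasure_indep, Finset.prod_eq_single i]
  · simp
  · intro j _ hj
    rw [if_neg hj, toOuterMeasure_univ]
  · simp

theorem indep_map_eval {ι α : Type*} [Fintype ι] (p : ι → PMF α) (i : ι) :
    (indep p).map (fun f => f i) = p i := by
  ext a
  rw [← PMF.toOuterMeasure_apply_singleton, ← PMF.toOuterMeasure_apply_singleton,
    PMF.toOuterMeasure_map_apply, ← toOuterMeasure_indep_eval p i]
  rfl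

theorem indep_bind_eval {ι α β : Type*} [Fintype ι] (p : ι → PMF α) (i : ι) (f : α → PMF β) :
    ((indep p).bind fun x => f (x i)) = (p i).bind f := by
  rw [← indep_map_eval p i, PMF.bind_map]
  rfl

theorem toOuterMeasure_add_compl {α : Type*} (p : PMF α) (E : Set α) :
    p.toOuterMeasure E + p.toOuterMeasure Eᶜ = 1 := by
  rw [PMF.toOuterMeasure_apply, PMF.toOuterMeasure_apply, ← ENNReal.tsum_add, ← p.tsum_coe]
  refine tsum_congr fun a => ?_
  by_cases ha : a ∈ E <;> simp [ha]

/-- If `f a` hits `E` with probability at most `ε₂` for all `a` outside an event of probability at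
most `ε₁`, then `p.bind f` hits `E` with probability at most `ε₁ + ε₂`. -/
theorem toOuterMeasure_bind_le {α β : Type*} {p : PMF α} {f : α → PMF β} {S : Set α} {E : Set β}
    {ε₁ ε₂ : ℝ≥0∞} (h₁ : p.toOuterMeasure S ≤ ε₁)
    (h₂ : ∀ a ∉ S, (f a).toOuterMeasure E ≤ ε₂) :
    (p.bind f).toOuterMeasure E ≤ ε₁ + ε₂ := by
  rw [PMF.toOuterMeasure_bind_apply]
  calc ∑' a, p a * (f a).toOuterMeasure E
      ≤ ∑' a, (S.indicator p a + p a * ε₂) := by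
        refine ENNReal.tsum_le_tsum fun a => ?_
        by_cases ha : a ∈ S
        · rw [Set.indicator_of_mem ha]
          exact le_add_right (mul_le_of_le_one_right' (toOuterMeasure_le_one _ _))
        · rw [Set.indicator_of_notMem ha, zero_add]
          gcongr
          exact h₂ a ha
    _ = p.toOuterMeasure S + ε₂ := by
        rw [ENNReal.tsum_add, ENNReal.tsum_mul_right, p.tsum_coe, one_mul, PMF.toOuterMeasure_apply]
    _ ≤ ε₁ + ε₂ := by gcongr

theorem toOuterMeasure_bind_le_of_forall {α β : Type*} {p : PMF α} {f : α → PMF β} {E : Set β}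
    {ε : ℝ≥0∞} (h : ∀ a, (f a).toOuterMeasure E ≤ ε) : (p.bind f).toOuterMeasure E ≤ ε := by
  simpa using toOuterMeasure_bind_le (p := p) (S := ∅) (ε₁ := 0) (by simp) fun a _ => h a

theorem toOuterMeasure_exists_le {ι α : Type*} (s : Finset ι) (p : PMF α) (E : ι → Set α)
    {ε : ℝ≥0∞} (h : ∀ i ∈ s, p.toOuterMeasure (E i) ≤ ε) :
    p.toOuterMeasure {a | ∃ i ∈ s, a ∈ E i} ≤ s.card * ε := by
  have : {a | ∃ i ∈ s, a ∈ E i} = ⋃ i ∈ s, E i := by ext; simp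
  rw [this]
  calc _ ≤ ∑ i ∈ s, p.toOuterMeasure (E i) := MeasureTheory.measure_biUnion_finset_le s E
    _ ≤ ∑ i ∈ s, ε := Finset.sum_le_sum h
    _ = _ := by simp

theorem toOuterMeasure_indep_exists_le {ι α : Type*} [Fintype ι] (p : ι → PMF α) (S : Set α)
    {ε : ℝ≥0∞} (h : ∀ i, (p i).toOuterMeasure S ≤ ε) :
    (indep p).toOuterMeasure {f | ∃ i, f i ∈ S} ≤ Fintype.card ι * ε := by
  have := toOuterMeasure_exists_le Finset.univ (indep p) (fun i => {f | f i ∈ S}) (ε := ε)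
    fun i _ => (toOuterMeasure_indep_eval p i S).trans_le (h i)
  simpa using this

/-- Expectations of `[0, 1]`-valued functions under close distributions are close. -/
theorem tsum_mul_le_add_statDist {α : Type*} (p p' : PMF α) (F : α → ℝ≥0∞) (hF : ∀ a, F a ≤ 1) :
    ∑' a, p a * F a ≤ ∑' a, p' a * F a + ENNReal.ofReal (2 * statDist p p') := by
  have hs : ∀ r : PMF α, Summable fun a => (r a).toReal := fun r =>
    ENNReal.summable_toReal (by simp [PMF.tsum_coe])
  have hs' : Summable fun a => |(p a).toReal - (p' a).toReal| := ((hs p).sub (hs p')).abs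
  have h : ENNReal.ofReal (2 * statDist p p')
      = ∑' a, ENNReal.ofReal |(p a).toReal - (p' a).toReal| := by
    rw [statDist, ← mul_assoc, mul_one_div_cancel two_ne_zero, one_mul,
      ENNReal.ofReal_tsum_of_nonneg (fun _ => abs_nonneg _) hs']
  rw [h, ← ENNReal.tsum_add]
  refine ENNReal.tsum_le_tsum fun a => ?_
  have h1 : p a ≤ p' a + ENNReal.ofReal |(p a).toReal - (p' a).toReal| := by
    rw [← ENNReal.ofReal_toReal (p.apply_ne_top a), ← ENNReal.ofReal_toReal (p'.apply_ne_top a),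
      ← ENNReal.ofReal_add ENNReal.toReal_nonneg (abs_nonneg _)]
    refine ENNReal.ofReal_le_ofReal ?_
    rw [ENNReal.toReal_ofReal ENNReal.toReal_nonneg, ENNReal.toReal_ofReal ENNReal.toReal_nonneg]
    linarith [le_abs_self ((p a).toReal - (p' a).toReal)]
  calc p a * F a ≤ (p' a + ENNReal.ofReal |(p a).toReal - (p' a).toReal|) * F a := by gcongr
    _ ≤ _ := by
      rw [add_mul]
      gcongr
      exact mul_le_of_le_one_right' (hF a)

/-- The factor 2 is not sharp: it comes from comparing the masses point by point without using that
both total 1. It only affects constants in the negligible term. -/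
theorem toOuterMeasure_le_add_statDist {α : Type*} (p p' : PMF α) (E : Set α) :
    p.toOuterMeasure E ≤ p'.toOuterMeasure E + ENNReal.ofReal (2 * statDist p p') := by
  classical
  have h := tsum_mul_le_add_statDist p p' (E.indicator 1) fun a => by
    by_cases ha : a ∈ E <;> simp [ha]
  simp only [PMF.toOuterMeasure_apply]
  convert h using 4 <;> simp [Set.indicator_apply]

/-! ### The discrete Gaussian -/

theorem discreteGaussian_toOuterMeasure {σ : ℝ} (hσ : 0 < σ) (S : Set ℤ) :
    (discreteGaussian σ).toOuterMeasure S
      = (∑' x, S.indicator (gaussWeight σ) x) / ∑' x, gaussWeight σ x := by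
  rw [PMF.toOuterMeasure_apply, discreteGaussian, dif_pos hσ, div_eq_mul_inv,
    ← ENNReal.tsum_mul_right]
  refine tsum_congr fun x => ?_
  by_cases hx : x ∈ S <;> simp [hx, PMF.normalize_apply]

/-- Moving `x` towards the origin by `s ≤ |x|` gives `(|x| - s)² + s² ≤ x²`. The sum of both shifts
avoids distinguishing the sign of `x`. -/
theorem gaussWeight_le_mul_add {σ : ℝ} {s : ℕ} {x : ℤ} (hx : (s : ℤ) ≤ |x|) :
    gaussWeight σ x ≤ ENNReal.ofReal (Real.exp (-Real.pi * (s : ℝ) ^ 2 / σ ^ 2))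
      * (gaussWeight σ (x - s) + gaussWeight σ (x + s)) := by
  have key : ∀ y : ℤ, (y : ℝ) ^ 2 + (s : ℝ) ^ 2 ≤ (x : ℝ) ^ 2 →
      gaussWeight σ x ≤ ENNReal.ofReal (Real.exp (-Real.pi * (s : ℝ) ^ 2 / σ ^ 2))
        * gaussWeight σ y := by
    intro y hy
    rw [gaussWeight, gaussWeight, ← ENNReal.ofReal_mul (Real.exp_pos _).le, ← Real.exp_add]
    refine ENNReal.ofReal_le_ofReal (Real.exp_le_exp.2 ?_)
    rw [← add_div]
    refine div_le_div_of_nonneg_right ?_ (sq_nonneg σ)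
    nlinarith [Real.pi_pos]
  rw [mul_add]
  have hs : (0 : ℝ) ≤ s := Nat.cast_nonneg s
  rcases le_abs.1 hx with h | h
  · refine (key (x - s) ?_).trans le_self_add
    have : (s : ℝ) ≤ x := by exact_mod_cast h
    push_cast
    nlinarith
  · refine (key (x + s) ?_).trans le_add_self
    have : (s : ℝ) ≤ -x := by exact_mod_cast h
    push_cast
    nlinarith

/-- Summing the shifted weights over all of `ℤ` reproduces the normalizing constant, so it cancels
and no estimate of it is needed. -/
theorem discreteGaussian_tail {σ : ℝ} (hσ : 0 < σ) (κ : ℕ) :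
    (discreteGaussian σ).toOuterMeasure {x | ¬ |(x : ℝ)| ≤ √κ * σ}
      ≤ ENNReal.ofReal (2 * Real.exp (-κ)) := by
  have hW := gaussWeight_tsum_ne_zero σ
  have hW' := gaussWeight_tsum_ne_top hσ
  -- The shift has to be an integer to preserve `ℤ`. This is the least integer exceeding `√κ σ`, so
  -- every integer in the tail satisfies `s ≤ |x|`.
  set s : ℕ := ⌊√κ * σ⌋₊ + 1 with hs
  have hsκ : √κ * σ ≤ s := by
    rw [hs]; push_cast; exact (Nat.lt_floor_add_one _).le
  set e := ENNReal.ofReal (Real.exp (-Real.pi * (s : ℝ) ^ 2 / σ ^ 2)) with he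
  have he' : e ≤ ENNReal.ofReal (Real.exp (-κ)) := by
    refine ENNReal.ofReal_le_ofReal (Real.exp_le_exp.2 ?_)
    rw [div_le_iff₀ (by positivity)]
    have h1 : (κ : ℝ) * σ ^ 2 ≤ (s : ℝ) ^ 2 := by
      calc (κ : ℝ) * σ ^ 2 = (√κ * σ) ^ 2 := by rw [mul_pow, Real.sq_sqrt (Nat.cast_nonneg κ)]
        _ ≤ (s : ℝ) ^ 2 := by gcongr
    nlinarith [Real.pi_gt_three, sq_nonneg (s : ℝ)]
  rw [discreteGaussian_toOuterMeasure hσ, ENNReal.div_le_iff hW hW']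
  calc ∑' x, {x : ℤ | ¬ |(x : ℝ)| ≤ √κ * σ}.indicator (gaussWeight σ) x
      ≤ ∑' x, e * (gaussWeight σ (x - s) + gaussWeight σ (x + s)) := by
        refine ENNReal.tsum_le_tsum fun x => ?_
        by_cases hx : |(x : ℝ)| ≤ √κ * σ
        · rw [Set.indicator_of_notMem (by simpa using hx)]
          exact zero_le
        · rw [Set.indicator_of_mem (by exact hx)]
          refine gaussWeight_le_mul_add ?_
          have h1 : ⌊√κ * σ⌋₊ < x.natAbs := by
            rw [Nat.floor_lt (by positivity), Nat.cast_natAbs, Int.cast_abs]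
            exact not_le.1 hx
          rw [Int.abs_eq_natAbs]
          omega
    _ = 2 * e * ∑' x, gaussWeight σ x := by
        have h1 : ∑' x : ℤ, gaussWeight σ (x - s) = ∑' x, gaussWeight σ x :=
          (Equiv.subRight (s : ℤ)).tsum_eq (gaussWeight σ)
        have h2 : ∑' x : ℤ, gaussWeight σ (x + s) = ∑' x, gaussWeight σ x :=
          (Equiv.addRight (s : ℤ)).tsum_eq (gaussWeight σ)
        rw [ENNReal.tsum_mul_left, ENNReal.tsum_add, h1, h2]
        ring
    _ ≤ _ := by
        rw [ENNReal.ofReal_mul zero_le_two]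
        gcongr
        simp

/-- As `q ≥ 3`, at most one of `k`, `k + 1`, `k + 2` lies in the residue class. So the sum over the
class and its translates by 1 and 2, with weight `g k` each, totals at most `∑ g`. By monotonicity
each translated sum dominates the sum over the class up to a boundary term `g 0`. -/
theorem three_mul_tsum_residue_le {q : ℕ} (hq : 2 < q) (c : ZMod q) {g : ℕ → ℝ≥0∞}
    (hg : Antitone g) :
    3 * ∑' k : ℕ, {k : ℕ | (k : ZMod q) = c}.indicator g k ≤ 2 * g 0 + ∑' k, g k := by
  classical
  set S : Set ℕ := {k : ℕ | (k : ZMod q) = c} with hS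
  have h2 : ∀ k j : ℕ, j = 1 ∨ j = 2 → k ∈ S → k + j ∉ S := by
    intro k j hj hk hk'
    have h0 : ((j : ℕ) : ZMod q) = 0 := by
      have : ((k : ZMod q) + (j : ZMod q)) = (k : ZMod q) := by
        rw [← Nat.cast_add]; exact hk'.trans hk.symm
      simpa using this
    rw [ZMod.natCast_eq_zero_iff] at h0
    have := Nat.le_of_dvd (by omega) h0
    omega
  have hT : ∑' k, S.indicator g k
      = S.indicator g 0 + S.indicator g 1 + ∑' k, S.indicator g (k + 2) := by
    rw [tsum_eq_zero_add' ENNReal.summable, tsum_eq_zero_add' ENNReal.summable, add_assoc]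
  have h01 : S.indicator g 0 + S.indicator g 1 ≤ g 0 := by
    by_cases h : 0 ∈ S
    · simp [h, h2 0 1 (by simp) h]
    · rw [Set.indicator_of_notMem h, zero_add]
      exact (Set.indicator_le_self _ _ _).trans (hg (by norm_num))
  have hA : ∑' k, S.indicator g (k + 2) ≤ ∑' k, if k + 2 ∈ S then g k else 0 := by
    refine ENNReal.tsum_le_tsum fun k => ?_
    rw [Set.indicator_apply]
    split_ifs
    · exact hg (by omega)
    · rfl
  have hB : ∑' k, S.indicator g (k + 2) ≤ ∑' k, if k + 1 ∈ S then g k else 0 := by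
    calc _ ≤ ∑' k, (fun k => if k + 1 ∈ S then g k else 0) (k + 1) := by
          refine ENNReal.tsum_le_tsum fun k => ?_
          simp only [Set.indicator_apply, add_assoc, one_add_one_eq_two]
          split_ifs
          · exact hg (by omega)
          · rfl
      _ ≤ _ := by
          rw [tsum_eq_zero_add' (f := fun k => if k + 1 ∈ S then g k else 0) ENNReal.summable]
          exact le_add_self
  have hsum : ∑' k, S.indicator g k + (∑' k, if k + 1 ∈ S then g k else 0)
      + (∑' k, if k + 2 ∈ S then g k else 0) ≤ ∑' k, g k := by
    rw [← ENNReal.tsum_add, ← ENNReal.tsum_add]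
    refine ENNReal.tsum_le_tsum fun k => ?_
    rw [Set.indicator_apply]
    have e1 := h2 k 1 (by simp)
    have e2 := h2 k 2 (by simp)
    have e3 := h2 (k + 1) 1 (by simp)
    rw [add_assoc, one_add_one_eq_two] at e3
    by_cases a : k ∈ S <;> by_cases b : k + 1 ∈ S <;> by_cases d : k + 2 ∈ S <;> simp_all
  calc 3 * ∑' k, S.indicator g k
      = ∑' k, S.indicator g k + (∑' k, S.indicator g k + ∑' k, S.indicator g k) := by ring
    _ ≤ ∑' k, S.indicator g k + ((g 0 + ∑' k, if k + 1 ∈ S then g k else 0)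
          + (g 0 + ∑' k, if k + 2 ∈ S then g k else 0)) := by
        gcongr
        · rw [hT]; gcongr
        · rw [hT]; gcongr
    _ = 2 * g 0 + (∑' k, S.indicator g k + (∑' k, if k + 1 ∈ S then g k else 0)
          + (∑' k, if k + 2 ∈ S then g k else 0)) := by ring
    _ ≤ _ := by gcongr

theorem gaussWeight_le_gaussWeight {σ : ℝ} {x y : ℤ} (h : |x| ≤ |y|) :
    gaussWeight σ y ≤ gaussWeight σ x := by
  refine ENNReal.ofReal_le_ofReal (Real.exp_le_exp.2 ?_)
  refine div_le_div_of_nonneg_right ?_ (sq_nonneg σ)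
  have : (x : ℝ) ^ 2 ≤ (y : ℝ) ^ 2 := by exact_mod_cast sq_le_sq.2 h
  nlinarith [Real.pi_pos]

theorem gaussWeight_le_one {σ : ℝ} (x : ℤ) : gaussWeight σ x ≤ 1 := by
  refine (gaussWeight_le_gaussWeight (x := 0) (by simp)).trans ?_
  simp [gaussWeight]

/-- The weight is monotone on each half-line. Substituting `x = -(k + 1)` turns the negative half
into the class of `-c - 1`, and each half contributes a boundary term of at most 2. -/
theorem three_mul_tsum_gaussWeight_residue_le {q : ℕ} (hq : 2 < q) (c : ZMod q) (σ : ℝ) :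
    3 * ∑' x : ℤ, {x : ℤ | (x : ZMod q) = c}.indicator (gaussWeight σ) x
      ≤ 4 + ∑' x, gaussWeight σ x := by
  have split : ∀ f : ℤ → ℝ≥0∞, ∑' x, f x = ∑' k : ℕ, f k + ∑' k : ℕ, f (-(k + 1)) := fun f =>
    tsum_of_nat_of_neg_add_one ENNReal.summable ENNReal.summable
  rw [split, split (gaussWeight σ), mul_add]
  have h1 := three_mul_tsum_residue_le hq c (g := fun k : ℕ => gaussWeight σ k)
    fun a b hab => gaussWeight_le_gaussWeight (by simpa using hab)
  have h2 := three_mul_tsum_residue_le hq (-c - 1) (g := fun k : ℕ => gaussWeight σ (-(k + 1)))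
    fun a b hab => gaussWeight_le_gaussWeight (by
      rw [abs_neg, abs_neg, abs_of_nonneg, abs_of_nonneg] <;> omega)
  have e2 : ∀ k : ℕ, {x : ℤ | (x : ZMod q) = c}.indicator (gaussWeight σ) (-(k + 1))
      = {k : ℕ | (k : ZMod q) = -c - 1}.indicator (fun k : ℕ => gaussWeight σ (-(k + 1))) k := by
    intro k
    simp only [Set.indicator_apply, Set.mem_ofPred_eq]
    congr 1
    push_cast
    rw [eq_iff_iff, neg_eq_iff_eq_neg, eq_sub_iff_add_eq]
  have e1 : ∀ k : ℕ, {x : ℤ | (x : ZMod q) = c}.indicator (gaussWeight σ) k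
      = {k : ℕ | (k : ZMod q) = c}.indicator (fun k : ℕ => gaussWeight σ k) k := by
    intro k
    simp [Set.indicator_apply]
  simp only [e1, e2]
  calc _ ≤ _ := add_le_add h1 h2
    _ ≤ (2 * 1 + ∑' k : ℕ, gaussWeight σ k) + (2 * 1 + ∑' k : ℕ, gaussWeight σ (-(k + 1))) := by
        gcongr <;> exact gaussWeight_le_one _
    _ = _ := by ring

/-- Each of the 1620 integers in `[0, 1620)` has weight at least `exp(-π) ≥ 3⁻⁴ = 1/81`, and `1620 /
81 = 20`. -/
theorem twenty_le_tsum_gaussWeight {σ : ℝ} (hσ : 1620 ≤ σ) : 20 ≤ ∑' x, gaussWeight σ x := by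
  have hπ : Real.exp (-Real.pi) ≥ 1 / 81 := by
    have h1 : Real.exp 1 ≤ 3 := Real.exp_one_lt_three.le
    rw [Real.exp_neg, ge_iff_le, one_div]
    refine inv_anti₀ (Real.exp_pos _) ?_
    calc Real.exp Real.pi ≤ Real.exp 4 := Real.exp_le_exp.2 Real.pi_le_four
      _ = Real.exp 1 ^ 4 := by rw [← Real.exp_nat_mul]; norm_num
      _ ≤ 3 ^ 4 := by gcongr
      _ = 81 := by norm_num
  have h1 : ∀ x ∈ Finset.Ico (0 : ℤ) 1620, ENNReal.ofReal (1 / 81) ≤ gaussWeight σ x := by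
    intro x hx
    rw [Finset.mem_Ico] at hx
    refine ENNReal.ofReal_le_ofReal (hπ.le.trans (Real.exp_le_exp.2 ?_))
    rw [le_div_iff₀ (by positivity)]
    have h2 : (x : ℝ) ≤ σ := le_trans (by exact_mod_cast hx.2.le) hσ
    have h0 : (0 : ℝ) ≤ x := by exact_mod_cast hx.1
    nlinarith [Real.pi_pos, mul_self_le_mul_self h0 h2]
  calc (20 : ℝ≥0∞) = ∑ x ∈ Finset.Ico (0 : ℤ) 1620, ENNReal.ofReal (1 / 81) := by
        rw [Finset.sum_const, Int.card_Ico, nsmul_eq_mul, ← ENNReal.ofReal_natCast,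
          ← ENNReal.ofReal_mul (by positivity)]
        rw [show (1620 - 0 : ℤ).toNat = 1620 from rfl,
          show ((1620 : ℕ) : ℝ) * (1 / 81) = 20 by norm_num, ENNReal.ofReal_ofNat]
    _ ≤ ∑ x ∈ Finset.Ico (0 : ℤ) 1620, gaussWeight σ x := Finset.sum_le_sum h1
    _ ≤ _ := ENNReal.sum_le_tsum _

/-- With total weight `W ≥ 20`, the class has weight at most `(4 + W) / 3 ≤ (W / 5 + W) / 3 = 2W /
5`. -/
theorem discreteGaussian_residue_le {q : ℕ} (hq : 2 < q) {σ : ℝ} (hσ : 1620 ≤ σ) (c : ZMod q) :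
    (discreteGaussian σ).toOuterMeasure {x | (x : ZMod q) = c} ≤ ENNReal.ofReal (2 / 5) := by
  have hσ0 : 0 < σ := by linarith
  have hW := gaussWeight_tsum_ne_zero σ
  have hW' := gaussWeight_tsum_ne_top hσ0
  rw [discreteGaussian_toOuterMeasure hσ0, ENNReal.div_le_iff hW hW']
  have h := three_mul_tsum_gaussWeight_residue_le hq c σ
  have h20 := twenty_le_tsum_gaussWeight hσ
  have hS : ∑' x : ℤ, {x : ℤ | (x : ZMod q) = c}.indicator (gaussWeight σ) x ≠ ∞ :=
    ne_top_of_le_ne_top hW' (ENNReal.tsum_le_tsum fun x => Set.indicator_le_self _ _ _)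
  generalize (∑' x, gaussWeight σ x) = W at *
  generalize (∑' x : ℤ, {x : ℤ | (x : ZMod q) = c}.indicator (gaussWeight σ) x) = S at *
  lift W to NNReal using hW'
  lift S to NNReal using hS
  have h' : (3 : ℝ) * S ≤ 4 + W := by exact_mod_cast h
  have h20' : (20 : ℝ) ≤ W := by exact_mod_cast h20
  rw [← ENNReal.ofReal_coe_nnreal, ← ENNReal.ofReal_coe_nnreal, ← ENNReal.ofReal_mul (by norm_num)]
  refine ENNReal.ofReal_le_ofReal ?_
  linarith

theorem gaussianVec_residue_le {ι : Type*} [Fintype ι] {q : ℕ} (hq : 2 < q) {σ : ℝ}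
    (hσ : 1620 ≤ σ) (z : ι → ZMod q) :
    (gaussianVec ι σ).toOuterMeasure {x | modVec q x = z}
      ≤ ENNReal.ofReal ((2 / 5) ^ Fintype.card ι) := by
  have : {x : ι → ℤ | modVec q x = z} = {x | ∀ i, x i ∈ {a : ℤ | (a : ZMod q) = z i}} := by
    ext x; exact funext_iff
  rw [this, gaussianVec, toOuterMeasure_indep, ENNReal.ofReal_pow (by norm_num)]
  exact Finset.prod_le_pow_card _ _ _ fun i _ => discreteGaussian_residue_le hq hσ (z i)

theorem gaussianVec_tail {ι : Type*} [Fintype ι] {σ : ℝ} (hσ : 0 < σ) (κ : ℕ) :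
    (gaussianVec ι σ).toOuterMeasure {x | ¬ ∀ i, |(x i : ℝ)| ≤ √κ * σ}
      ≤ ENNReal.ofReal (Fintype.card ι * (2 * Real.exp (-κ))) := by
  have h := toOuterMeasure_indep_exists_le (fun _ : ι => discreteGaussian σ)
    {x : ℤ | ¬ |(x : ℝ)| ≤ √κ * σ} fun _ => discreteGaussian_tail hσ κ
  rw [ENNReal.ofReal_mul (Nat.cast_nonneg _), ENNReal.ofReal_natCast]
  simpa [gaussianVec] using h

/-! ### Second moments for a uniform matrix -/

theorem card_fiber_mul_card {M G : Type*} [AddCommGroup M] [AddCommGroup G] [Fintype M]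
    [Fintype G] [DecidableEq G] (f : M →+ G) (hf : Function.Surjective f) (g : G) :
    (Finset.univ.filter fun A => f A = g).card * Fintype.card G = Fintype.card M := by
  have h : ∀ g' : G, (Finset.univ.filter fun A => f A = g').card
      = (Finset.univ.filter fun A => f A = g).card := fun g' =>
    AddMonoidHom.card_fiber_eq_of_mem_range f (hf g') (hf g)
  have h2 := Finset.card_eq_sum_card_fiberwise (f := f) (s := Finset.univ) (t := Finset.univ)
    fun _ _ => Finset.mem_coe.2 (Finset.mem_univ _)
  simp only [h, Finset.sum_const, smul_eq_mul] at h2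
  rw [← Finset.card_univ, ← Finset.card_univ, h2, mul_comm]

section

variable {n q : ℕ} [Fact q.Prime] {ι : Type*} [Fintype ι] [DecidableEq ι]

/-- `A ↦ A z`, as an additive homomorphism. -/
def mulVecHom (n : ℕ) (z : ι → ZMod q) : Matrix (Fin n) ι (ZMod q) →+ (Fin n → ZMod q) where
  toFun A := A *ᵥ z
  map_zero' := Matrix.zero_mulVec z
  map_add' A B := Matrix.add_mulVec A B z

/-- Non-proportional vectors have a nonzero 2 × 2 minor, so two columns of `A` suffice. -/
theorem exists_mulVec_eq_of_pair {z z' : ι → ZMod q} (hz : z ≠ 0) (hz' : ∀ c : ZMod q, z' ≠ c • z)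
    (a b : Fin n → ZMod q) :
    ∃ A : Matrix (Fin n) ι (ZMod q), A *ᵥ z = a ∧ A *ᵥ z' = b := by
  obtain ⟨i, hi⟩ := Function.ne_iff.1 hz
  obtain ⟨j, hj⟩ := Function.ne_iff.1 (hz' (z' i / z i))
  simp only [Pi.zero_apply, Pi.smul_apply, smul_eq_mul, ne_eq] at hi hj
  have hd : z i * z' j - z j * z' i ≠ 0 := by
    intro h
    apply hj
    field_simp
    linear_combination h
  -- Cramer's rule in columns `i` and `j`. Adding the two contributions makes it unnecessary to
  -- prove `i ≠ j` separately.
  refine ⟨fun k l => (if l = i then (a k * z' j - b k * z j) / (z i * z' j - z j * z' i) else 0)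
    + (if l = j then (b k * z i - a k * z' i) / (z i * z' j - z j * z' i) else 0), ?_, ?_⟩ <;>
  · ext k
    simp only [Matrix.mulVec, dotProduct, add_mul, ite_mul, zero_mul, Finset.sum_add_distrib,
      Finset.sum_ite_eq', Finset.mem_univ, if_true]
    rw [div_mul_eq_mul_div, div_mul_eq_mul_div, ← add_div, div_eq_iff hd]
    ring

theorem exists_mulVec_eq {z : ι → ZMod q} (hz : z ≠ 0) (a : Fin n → ZMod q) :
    ∃ A : Matrix (Fin n) ι (ZMod q), A *ᵥ z = a := by
  obtain ⟨i, hi⟩ := Function.ne_iff.1 hz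
  refine ⟨fun k l => if l = i then a k / z i else 0, ?_⟩
  ext k
  simp only [Pi.zero_apply] at hi
  simp [Matrix.mulVec, dotProduct, hi]

theorem card_mulVec_eq {z : ι → ZMod q} (hz : z ≠ 0) (y : Fin n → ZMod q) :
    (Finset.univ.filter fun A : Matrix (Fin n) ι (ZMod q) => A *ᵥ z = y).card * q ^ n
      = Fintype.card (Matrix (Fin n) ι (ZMod q)) := by
  have h := card_fiber_mul_card (mulVecHom n z) (exists_mulVec_eq hz) y
  rw [Fintype.card_fun, ZMod.card, Fintype.card_fin] at h
  exact h

theorem card_mulVec_eq_pair {z z' : ι → ZMod q} (hz : z ≠ 0) (hz' : ∀ c : ZMod q, z' ≠ c • z)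
    (y : Fin n → ZMod q) :
    (Finset.univ.filter fun A : Matrix (Fin n) ι (ZMod q) => A *ᵥ z = y ∧ A *ᵥ z' = y).card
        * (q ^ n * q ^ n)
      = Fintype.card (Matrix (Fin n) ι (ZMod q)) := by
  have h := card_fiber_mul_card ((mulVecHom n z).prod (mulVecHom n z')) (fun ab => by
    obtain ⟨A, hA, hA'⟩ := exists_mulVec_eq_of_pair hz hz' ab.1 ab.2
    exact ⟨A, Prod.ext hA hA'⟩) (y, y)
  rw [Fintype.card_prod, Fintype.card_fun, ZMod.card, Fintype.card_fin] at h
  rw [← h]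
  congr 3
  ext A
  change _ ↔ (A *ᵥ z, A *ᵥ z') = (y, y)
  rw [Prod.mk.injEq]

/-- The mass which `μ` gives to the solutions `z` of `A z = y`. -/
def fiberMass (μ : (ι → ZMod q) → ℝ) (y : Fin n → ZMod q) (A : Matrix (Fin n) ι (ZMod q)) : ℝ :=
  ∑ z, if A *ᵥ z = y then μ z else 0

theorem sum_fiberMass (μ : (ι → ZMod q) → ℝ) (y : Fin n → ZMod q) :
    ∑ A, fiberMass μ y A
      = ∑ z, μ z * (Finset.univ.filter fun A : Matrix (Fin n) ι (ZMod q) => A *ᵥ z = y).card := by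
  simp only [fiberMass]
  rw [Finset.sum_comm]
  refine Finset.sum_congr rfl fun z _ => ?_
  rw [← Finset.sum_filter, Finset.sum_const, nsmul_eq_mul, mul_comm]

theorem card_mulVec_eq_real {z : ι → ZMod q} (hz : z ≠ 0) (y : Fin n → ZMod q) :
    ((Finset.univ.filter fun A : Matrix (Fin n) ι (ZMod q) => A *ᵥ z = y).card : ℝ)
      = Fintype.card (Matrix (Fin n) ι (ZMod q)) / (q : ℝ) ^ n := by
  have hq : (0 : ℝ) < q := Nat.cast_pos.2 (Fact.out : q.Prime).pos
  rw [eq_div_iff (by positivity)]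
  exact_mod_cast card_mulVec_eq hz y

theorem sum_fiberMass_le {μ : (ι → ZMod q) → ℝ} (hμ : ∀ z, 0 ≤ μ z) (y : Fin n → ZMod q) :
    ∑ A, fiberMass μ y A
      ≤ Fintype.card (Matrix (Fin n) ι (ZMod q)) * ((∑ z, μ z) / (q : ℝ) ^ n + μ 0) := by
  set N : ℝ := (Fintype.card (Matrix (Fin n) ι (ZMod q)) : ℝ) with hN
  have hq : (0 : ℝ) < q := Nat.cast_pos.2 (Fact.out : q.Prime).pos
  rw [sum_fiberMass]
  calc _ ≤ ∑ z, (μ z * (N / (q : ℝ) ^ n) + if z = 0 then μ z * N else 0) := by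
        refine Finset.sum_le_sum fun z _ => ?_
        split_ifs with hz
        · refine le_add_of_nonneg_of_le (mul_nonneg (hμ z) (by positivity)) ?_
          gcongr
          · exact hμ z
          · exact Nat.cast_le.2 (Finset.card_le_univ _)
        · rw [card_mulVec_eq_real hz, add_zero]
    _ = _ := by
        rw [Finset.sum_add_distrib, ← Finset.sum_mul, Finset.sum_ite_eq']
        simp only [Finset.mem_univ, if_true]
        ring

theorem le_sum_fiberMass {μ : (ι → ZMod q) → ℝ} (hμ : ∀ z, 0 ≤ μ z) (y : Fin n → ZMod q) :
    Fintype.card (Matrix (Fin n) ι (ZMod q)) * ((∑ z, μ z - μ 0) / (q : ℝ) ^ n)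
      ≤ ∑ A, fiberMass μ y A := by
  set N : ℝ := (Fintype.card (Matrix (Fin n) ι (ZMod q)) : ℝ) with hN
  rw [sum_fiberMass]
  calc _ = ∑ z, (μ z * (N / (q : ℝ) ^ n) - if z = 0 then μ z * (N / (q : ℝ) ^ n) else 0) := by
        rw [Finset.sum_sub_distrib, ← Finset.sum_mul, Finset.sum_ite_eq']
        simp only [Finset.mem_univ, if_true]
        ring
    _ ≤ _ := by
        refine Finset.sum_le_sum fun z _ => ?_
        split_ifs with hz
        · rw [sub_self]
          exact mul_nonneg (hμ z) (Nat.cast_nonneg _)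
        · rw [card_mulVec_eq_real hz, sub_zero]

/-- The three summands cover independent pairs (two conditions), pairs with a dependence but a
nonzero member (one condition), and the pair `(0, 0)` (no condition). The count over `c` may
overcount, which is harmless for an upper bound. -/
theorem card_mulVec_eq_and_le (z z' : ι → ZMod q) (y : Fin n → ZMod q) :
    ((Finset.univ.filter fun A : Matrix (Fin n) ι (ZMod q) => A *ᵥ z = y ∧ A *ᵥ z' = y).card : ℝ)
      ≤ Fintype.card (Matrix (Fin n) ι (ZMod q)) *
        (1 / ((q : ℝ) ^ n * (q : ℝ) ^ n)
          + ((if z = 0 then 1 else 0) + ∑ c : ZMod q, if z' = c • z then 1 else 0) / (q : ℝ) ^ n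
          + (if z = 0 then 1 else 0) * (if z' = 0 then 1 else 0)) := by
  set N : ℝ := (Fintype.card (Matrix (Fin n) ι (ZMod q)) : ℝ) with hN
  have hq : (0 : ℝ) < q := Nat.cast_pos.2 (Fact.out : q.Prime).pos
  have hN0 : 0 ≤ N := Nat.cast_nonneg _
  have hs : (0 : ℝ) ≤ ∑ c : ZMod q, if z' = c • z then 1 else 0 :=
    Finset.sum_nonneg fun c _ => by split_ifs <;> norm_num
  have hle : ∀ w : ι → ZMod q, (w = z ∨ w = z') → w ≠ 0 →
      ((Finset.univ.filter fun A : Matrix (Fin n) ι (ZMod q) =>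
        A *ᵥ z = y ∧ A *ᵥ z' = y).card : ℝ) ≤ N * (1 / (q : ℝ) ^ n) := by
    intro w hw hw0
    rw [mul_one_div, ← card_mulVec_eq_real hw0 y]
    refine Nat.cast_le.2 (Finset.card_le_card fun A => ?_)
    simp only [Finset.mem_filter, Finset.mem_univ, true_and]
    rintro ⟨h1, h2⟩
    rcases hw with rfl | rfl
    exacts [h1, h2]
  by_cases hz : z = 0
  · by_cases hz' : z' = 0
    · calc _ ≤ N * 1 := by rw [mul_one]; exact Nat.cast_le.2 (Finset.card_le_univ _)
        _ ≤ _ := by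
          gcongr
          simp only [hz, hz', if_true, mul_one]
          refine le_add_of_nonneg_left ?_
          rw [hz, hz'] at hs
          positivity
    · refine (hle z' (Or.inr rfl) hz').trans ?_
      gcongr
      simp only [hz, hz', if_true, if_false, mul_zero, add_zero]
      rw [hz] at hs
      refine le_add_of_nonneg_of_le (by positivity) ?_
      gcongr
      exact le_add_of_nonneg_right hs
  · simp only [hz, if_false, zero_mul, zero_add, add_zero]
    by_cases hd : ∃ c : ZMod q, z' = c • z
    · obtain ⟨c, hc⟩ := hd
      refine (hle z (Or.inl rfl) hz).trans ?_
      gcongr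
      refine le_add_of_nonneg_of_le (by positivity) ?_
      gcongr
      have := Finset.single_le_sum (f := fun c : ZMod q => if z' = c • z then (1 : ℝ) else 0)
        (fun c _ => by split_ifs <;> norm_num) (Finset.mem_univ c)
      simpa [hc] using this
    · rw [not_exists] at hd
      have h := card_mulVec_eq_pair hz hd y
      have h' : ((Finset.univ.filter fun A : Matrix (Fin n) ι (ZMod q) =>
          A *ᵥ z = y ∧ A *ᵥ z' = y).card : ℝ) = N * (1 / ((q : ℝ) ^ n * (q : ℝ) ^ n)) := by
        rw [mul_one_div, eq_div_iff (by positivity), hN]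
        exact_mod_cast h
      rw [h']
      gcongr
      exact le_add_of_nonneg_right (by positivity)

/-- Expand the square over pairs. A vector has at most `q` multiples, each of mass at most `δ`, so
proportional pairs cost `q δ`; the zero vector accounts for the remaining `δ / qⁿ` and `δ²`. -/
theorem sum_fiberMass_sq_le {μ : (ι → ZMod q) → ℝ} (hμ : ∀ z, 0 ≤ μ z) (h1 : ∑ z, μ z = 1)
    {δ : ℝ} (hδ : ∀ z, μ z ≤ δ) (y : Fin n → ZMod q) :
    ∑ A, fiberMass μ y A ^ 2
      ≤ Fintype.card (Matrix (Fin n) ι (ZMod q)) *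
        (1 / ((q : ℝ) ^ n * (q : ℝ) ^ n) + (q + 1) * δ / (q : ℝ) ^ n + δ ^ 2) := by
  set N : ℝ := (Fintype.card (Matrix (Fin n) ι (ZMod q)) : ℝ) with hN
  have hq : (0 : ℝ) < q := Nat.cast_pos.2 (Fact.out : q.Prime).pos
  have hδ0 : 0 ≤ δ := (hμ 0).trans (hδ 0)
  have e1 : ∑ A, fiberMass μ y A ^ 2 = ∑ z, ∑ z', μ z * μ z' *
      (Finset.univ.filter fun A : Matrix (Fin n) ι (ZMod q) =>
        A *ᵥ z = y ∧ A *ᵥ z' = y).card := by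
    simp only [fiberMass, sq, Finset.sum_mul_sum]
    rw [Finset.sum_comm]
    refine Finset.sum_congr rfl fun z _ => ?_
    rw [Finset.sum_comm]
    refine Finset.sum_congr rfl fun z' _ => ?_
    rw [mul_comm, ← nsmul_eq_mul, ← Finset.sum_const, Finset.sum_filter]
    refine Finset.sum_congr rfl fun A _ => ?_
    by_cases h1 : A *ᵥ z = y <;> by_cases h2 : A *ᵥ z' = y <;> simp [h1, h2]
  have hsum : ∀ z : ι → ZMod q,
      ∑ z', μ z' * (∑ c : ZMod q, if z' = c • z then (1 : ℝ) else 0) = ∑ c : ZMod q, μ (c • z) := by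
    intro z
    simp only [Finset.mul_sum]
    rw [Finset.sum_comm]
    refine Finset.sum_congr rfl fun c _ => ?_
    simp
  rw [e1]
  calc _ ≤ ∑ z, ∑ z', μ z * μ z' * (N *
        (1 / ((q : ℝ) ^ n * (q : ℝ) ^ n)
          + ((if z = 0 then 1 else 0) + ∑ c : ZMod q, if z' = c • z then 1 else 0) / (q : ℝ) ^ n
          + (if z = 0 then 1 else 0) * (if z' = 0 then 1 else 0))) := by
        refine Finset.sum_le_sum fun z _ => Finset.sum_le_sum fun z' _ => ?_
        exact mul_le_mul_of_nonneg_left (card_mulVec_eq_and_le z z' y)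
          (mul_nonneg (hμ z) (hμ z'))
    _ = ∑ z, N * (μ z * (1 / ((q : ℝ) ^ n * (q : ℝ) ^ n) * ∑ z', μ z'
          + ((if z = 0 then 1 else 0) * ∑ z', μ z'
            + ∑ z', μ z' * (∑ c : ZMod q, if z' = c • z then (1 : ℝ) else 0)) / (q : ℝ) ^ n
          + (if z = 0 then 1 else 0) * ∑ z', μ z' * if z' = 0 then 1 else 0)) := by
        refine Finset.sum_congr rfl fun z _ => ?_
        simp only [Finset.mul_sum, Finset.sum_div, ← Finset.sum_add_distrib]
        refine Finset.sum_congr rfl fun z' _ => ?_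
        rw [← Finset.mul_sum]
        ring
    _ ≤ ∑ z, N * (μ z * (1 / ((q : ℝ) ^ n * (q : ℝ) ^ n)
          + ((if z = 0 then 1 else 0) + q * δ) / (q : ℝ) ^ n
          + (if z = 0 then 1 else 0) * δ)) := by
        refine Finset.sum_le_sum fun z _ => ?_
        rw [h1, hsum, mul_one, mul_one]
        have h2 : ∑ c : ZMod q, μ (c • z) ≤ q * δ := by
          calc _ ≤ ∑ _c : ZMod q, δ := Finset.sum_le_sum fun c _ => hδ _
            _ = _ := by simp [ZMod.card]
        have h3 : (∑ z', μ z' * if z' = 0 then (1 : ℝ) else 0) ≤ δ := by simpa using hδ 0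
        have := hμ z
        gcongr
    _ = N * ((∑ z, μ z) * (1 / ((q : ℝ) ^ n * (q : ℝ) ^ n) + q * δ / (q : ℝ) ^ n)
          + μ 0 * (1 / (q : ℝ) ^ n + δ)) := by
        have h3 : μ 0 = ∑ z, μ z * if z = 0 then (1 : ℝ) else 0 := by simp
        rw [h3, Finset.sum_mul, Finset.sum_mul, ← Finset.sum_add_distrib, Finset.mul_sum]
        refine Finset.sum_congr rfl fun z _ => ?_
        ring
    _ ≤ N * (1 * (1 / ((q : ℝ) ^ n * (q : ℝ) ^ n) + q * δ / (q : ℝ) ^ n)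
          + δ * (1 / (q : ℝ) ^ n + δ)) := by
        rw [h1]
        gcongr
        exact hδ 0
    _ = _ := by ring

/-- The cross term enters negatively, so the lower bound on the mean is needed too; the loss of `μ
0` there produces the last summand. -/
theorem sum_fiberMass_sub_sq_le {μ : (ι → ZMod q) → ℝ} (hμ : ∀ z, 0 ≤ μ z) (h1 : ∑ z, μ z = 1)
    {δ : ℝ} (hδ : ∀ z, μ z ≤ δ) (y : Fin n → ZMod q) :
    ∑ A, (fiberMass μ y A - 1 / (q : ℝ) ^ n) ^ 2
      ≤ Fintype.card (Matrix (Fin n) ι (ZMod q)) *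
        ((q + 1) * δ / (q : ℝ) ^ n + δ ^ 2 + 2 * δ / ((q : ℝ) ^ n * (q : ℝ) ^ n)) := by
  set N : ℝ := (Fintype.card (Matrix (Fin n) ι (ZMod q)) : ℝ) with hN
  have hq : (0 : ℝ) < q := Nat.cast_pos.2 (Fact.out : q.Prime).pos
  have h2 := sum_fiberMass_sq_le hμ h1 hδ y
  have h3 := le_sum_fiberMass hμ y
  rw [h1] at h3
  have h4 : N * ((1 - δ) / (q : ℝ) ^ n) ≤ ∑ A, fiberMass μ y A := by
    refine le_trans ?_ h3
    gcongr
    exact hδ 0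
  have e : ∑ A, (fiberMass μ y A - 1 / (q : ℝ) ^ n) ^ 2 = ∑ A, fiberMass μ y A ^ 2
      - 2 / (q : ℝ) ^ n * ∑ A, fiberMass μ y A + N * (1 / ((q : ℝ) ^ n * (q : ℝ) ^ n)) := by
    simp only [sub_sq, Finset.sum_add_distrib, Finset.sum_sub_distrib, Finset.sum_const,
      Finset.card_univ, nsmul_eq_mul, Finset.mul_sum, ← hN]
    congr 1
    · congr 1
      refine Finset.sum_congr rfl fun A _ => ?_
      ring
    · ring
  rw [e]
  have h5 := mul_le_mul_of_nonneg_left h4 (show 0 ≤ 2 / (q : ℝ) ^ n by positivity)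
  have e2 : N * ((q + 1) * δ / (q : ℝ) ^ n + δ ^ 2 + 2 * δ / ((q : ℝ) ^ n * (q : ℝ) ^ n))
      = N * (1 / ((q : ℝ) ^ n * (q : ℝ) ^ n) + (q + 1) * δ / (q : ℝ) ^ n + δ ^ 2)
        - 2 / (q : ℝ) ^ n * (N * ((1 - δ) / (q : ℝ) ^ n))
        + N * (1 / ((q : ℝ) ^ n * (q : ℝ) ^ n)) := by
    field_simp
    ring
  rw [e2]
  linarith

end

/-! ### Gaussian preimages under a uniform matrix -/

theorem toOuterMeasure_ne_top {α : Type*} (p : PMF α) (E : Set α) : p.toOuterMeasure E ≠ ∞ :=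
  ne_top_of_le_ne_top ENNReal.one_ne_top (toOuterMeasure_le_one p E)

theorem toOuterMeasure_inter_eq_sum {α β : Type*} [Fintype β] (p : PMF α) (E : Set α) (g : α → β)
    (P : β → Prop) [DecidablePred P] :
    (p.toOuterMeasure (E ∩ {x | P (g x)})).toReal
      = ∑ z, if P z then (p.toOuterMeasure (E ∩ {x | g x = z})).toReal else 0 := by
  classical
  have h : p.toOuterMeasure (E ∩ {x | P (g x)})
      = ∑ z, if P z then p.toOuterMeasure (E ∩ {x | g x = z}) else 0 := by
    rw [← Finset.sum_filter]
    simp only [PMF.toOuterMeasure_apply]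
    rw [← Summable.tsum_finsetSum fun _ _ => ENNReal.summable]
    refine tsum_congr fun a => ?_
    by_cases ha : a ∈ E <;> simp [Set.indicator_apply, ha]
  rw [h, ENNReal.toReal_sum]
  · refine Finset.sum_congr rfl fun z _ => ?_
    split_ifs <;> rfl
  · intro z _
    split_ifs
    · exact toOuterMeasure_ne_top p _
    · exact ENNReal.zero_ne_top

section

variable {n q : ℕ} {ι : Type*} [Fintype ι]

/-- Chebyshev's inequality in pointwise form, ready to be averaged over `A`. If the mass of
solutions is below `1 / (2Q)`, the first term is at least 1. Otherwise conditioning divides by at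
least `1 / (2Q)`. The default value of `gaussianPreimage` can occur only in the first case. -/
theorem gaussianPreimage_toOuterMeasure_le (A : Matrix (Fin n) ι (ZMod q)) (y : Fin n → ZMod q)
    (σ : ℝ) (S : Set (ι → ℤ)) {Q : ℝ} (hQ : 0 < Q) :
    ((gaussianPreimage A y σ).toOuterMeasure {x | A *ᵥ modVec q x ≠ y ∨ x ∈ S}).toReal
      ≤ 4 * Q ^ 2 * (((gaussianVec ι σ).toOuterMeasure
            {x | A *ᵥ modVec q x = y}).toReal - 1 / Q) ^ 2
        + 2 * Q * ((gaussianVec ι σ).toOuterMeasure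
            (S ∩ {x | A *ᵥ modVec q x = y})).toReal := by
  classical
  set p := gaussianVec ι σ
  set Y : Set (ι → ℤ) := {x | A *ᵥ modVec q x = y} with hY
  have hβ : 0 ≤ (p.toOuterMeasure (S ∩ Y)).toReal := ENNReal.toReal_nonneg
  have h1 : ((gaussianPreimage A y σ).toOuterMeasure
      {x | A *ᵥ modVec q x ≠ y ∨ x ∈ S}).toReal ≤ 1 :=
    ENNReal.toReal_le_of_le_ofReal zero_le_one (by simpa using toOuterMeasure_le_one _ _)
  by_cases hp : (p.toOuterMeasure Y).toReal < 1 / (2 * Q)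
  · refine h1.trans (le_add_of_le_of_nonneg ?_ (by positivity))
    have h2 : 1 / (2 * Q) ≤ 1 / Q - (p.toOuterMeasure Y).toReal := by
      have : 1 / Q = 1 / (2 * Q) + 1 / (2 * Q) := by field_simp; norm_num
      linarith
    have h3 : (1 / (2 * Q)) ^ 2 ≤ (1 / Q - (p.toOuterMeasure Y).toReal) ^ 2 := by gcongr
    calc (1 : ℝ) = 4 * Q ^ 2 * (1 / (2 * Q)) ^ 2 := by field_simp; norm_num
      _ ≤ 4 * Q ^ 2 * (1 / Q - (p.toOuterMeasure Y).toReal) ^ 2 := by gcongr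
      _ = _ := by ring
  · rw [not_lt] at hp
    have hpos : 0 < (p.toOuterMeasure Y).toReal := lt_of_lt_of_le (by positivity) hp
    have hne : p.toOuterMeasure Y ≠ 0 := fun h => by simp [h] at hpos
    have hex : ∃ x ∈ Y, x ∈ p.support := by
      by_contra hcon
      exact hne ((PMF.toOuterMeasure_apply_eq_zero_iff p Y).2
        (Set.disjoint_left.2 fun x hx hx' => hcon ⟨x, hx', hx⟩))
    refine le_add_of_nonneg_of_le (by positivity) ?_
    have key : (gaussianPreimage A y σ).toOuterMeasure {x | A *ᵥ modVec q x ≠ y ∨ x ∈ S}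
        = p.toOuterMeasure (S ∩ Y) * (p.toOuterMeasure Y)⁻¹ := by
      rw [gaussianPreimage, dif_pos hex]
      simp only [PMF.toOuterMeasure_apply]
      rw [← ENNReal.tsum_mul_right]
      refine tsum_congr fun x => ?_
      by_cases hx : x ∈ Y
      · have hx' : A *ᵥ modVec q x = y := hx
        by_cases hxS : x ∈ S
        · rw [Set.indicator_of_mem (by exact Or.inr hxS), Set.indicator_of_mem (by exact ⟨hxS, hx⟩),
            PMF.filter_apply, Set.indicator_of_mem hx]
        · rw [Set.indicator_of_notMem (by simp [hx', hxS]), Set.indicator_of_notMem (by simp [hxS]),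
            zero_mul]
      · have hx' : A *ᵥ modVec q x ≠ y := hx
        rw [Set.indicator_of_mem (by exact Or.inl hx'), Set.indicator_of_notMem (by simp [hx]),
          PMF.filter_apply, Set.indicator_of_notMem hx]
    rw [key, ENNReal.toReal_mul, ENNReal.toReal_inv, ← div_eq_mul_inv, div_le_iff₀ hpos]
    calc (p.toOuterMeasure (S ∩ Y)).toReal
        = 2 * Q * (p.toOuterMeasure (S ∩ Y)).toReal * (1 / (2 * Q)) := by field_simp
      _ ≤ _ := by gcongr

variable [Fact q.Prime] [DecidableEq ι]

/-- The pointwise bound with `Q = qⁿ`, averaged over `A`: the second moment handles the full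
Gaussian, while a first moment suffices for its restriction to `S`. -/
theorem sum_gaussianPreimage_toOuterMeasure_le {σ δ : ℝ}
    (hδ : ∀ z : ι → ZMod q, (gaussianVec ι σ).toOuterMeasure {x | modVec q x = z}
      ≤ ENNReal.ofReal δ) (hδ0 : 0 ≤ δ) (y : Fin n → ZMod q) (S : Set (ι → ℤ)) :
    ∑ A : Matrix (Fin n) ι (ZMod q),
        ((gaussianPreimage A y σ).toOuterMeasure {x | A *ᵥ modVec q x ≠ y ∨ x ∈ S}).toReal
      ≤ Nat.card (Matrix (Fin n) ι (ZMod q)) *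
        (4 * (q + 1) * ((q : ℝ) ^ n * δ) + 4 * ((q : ℝ) ^ n * δ) ^ 2 + 8 * δ
          + 2 * ((gaussianVec ι σ).toOuterMeasure S).toReal + 2 * ((q : ℝ) ^ n * δ)) := by
  rw [Nat.card_eq_fintype_card]
  have hq : (0 : ℝ) < q := Nat.cast_pos.2 (Fact.out : q.Prime).pos
  set p := gaussianVec ι σ
  set μ : Set (ι → ℤ) → (ι → ZMod q) → ℝ := fun E z =>
    (p.toOuterMeasure (E ∩ {x | modVec q x = z})).toReal with hμ
  have hμ0 : ∀ E z, 0 ≤ μ E z := fun E z => ENNReal.toReal_nonneg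
  have hμδ : ∀ E z, μ E z ≤ δ := fun E z => ENNReal.toReal_le_of_le_ofReal hδ0
    ((p.toOuterMeasure.mono Set.inter_subset_right).trans (hδ z))
  have hsum : ∀ E, ∑ z, μ E z = (p.toOuterMeasure E).toReal := by
    intro E
    have := toOuterMeasure_inter_eq_sum p E (modVec q) (fun _ => True)
    simpa using this.symm
  have hfib : ∀ E (A : Matrix (Fin n) ι (ZMod q)),
      (p.toOuterMeasure (E ∩ {x | A *ᵥ modVec q x = y})).toReal = fiberMass (μ E) y A := fun E A =>
    toOuterMeasure_inter_eq_sum p E (modVec q) (fun z => A *ᵥ z = y)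
  have h1 := sum_fiberMass_sub_sq_le (hμ0 Set.univ) (by rw [hsum, toOuterMeasure_univ]; rfl)
    (hμδ Set.univ) y
  have h2 := sum_fiberMass_le (hμ0 S) y
  rw [hsum] at h2
  set N : ℝ := (Fintype.card (Matrix (Fin n) ι (ZMod q)) : ℝ) with hN
  have hN0 : 0 ≤ N := Nat.cast_nonneg _
  calc _ ≤ ∑ A : Matrix (Fin n) ι (ZMod q),
        (4 * ((q : ℝ) ^ n) ^ 2 * (fiberMass (μ Set.univ) y A - 1 / (q : ℝ) ^ n) ^ 2
          + 2 * (q : ℝ) ^ n * fiberMass (μ S) y A) := by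
        refine Finset.sum_le_sum fun A _ => ?_
        have := gaussianPreimage_toOuterMeasure_le A y σ S (Q := (q : ℝ) ^ n) (by positivity)
        rw [← hfib, ← hfib, Set.univ_inter]
        exact this
    _ = 4 * ((q : ℝ) ^ n) ^ 2 * ∑ A, (fiberMass (μ Set.univ) y A - 1 / (q : ℝ) ^ n) ^ 2
          + 2 * (q : ℝ) ^ n * ∑ A, fiberMass (μ S) y A := by
        rw [Finset.sum_add_distrib, Finset.mul_sum, Finset.mul_sum]
    _ ≤ 4 * ((q : ℝ) ^ n) ^ 2 * (N *
          ((q + 1) * δ / (q : ℝ) ^ n + δ ^ 2 + 2 * δ / ((q : ℝ) ^ n * (q : ℝ) ^ n)))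
          + 2 * (q : ℝ) ^ n * (N * ((p.toOuterMeasure S).toReal / (q : ℝ) ^ n + δ)) := by
        gcongr
        refine h2.trans ?_
        gcongr
        exact hμδ S 0
    _ = _ := by
        field_simp
        ring

end

/-- The product equals `(2 (4/5)ⁿ) ^ L`, since `2 · 2/5 = 4/5`. From `n = 4` on the base is at most
1, so its `L`-th power is at most the base, uniformly in `L`. -/
theorem pow_mul_two_fifths_pow_le {n L : ℕ} (hL : L ≠ 0) (hn : 4 ≤ n) :
    ((2 : ℝ) ^ L) ^ (n + 1) * (2 / 5) ^ (n * L) ≤ 2 * (4 / 5) ^ n ∧ (2 : ℝ) * (4 / 5) ^ n ≤ 1 := by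
  have h1 : (2 : ℝ) * (4 / 5) ^ n ≤ 1 := by
    calc (2 : ℝ) * (4 / 5) ^ n ≤ 2 * (4 / 5) ^ 4 := by
          gcongr 2 * ?_
          exact pow_le_pow_of_le_one (by norm_num) (by norm_num) hn
      _ ≤ 1 := by norm_num
  refine ⟨?_, h1⟩
  calc ((2 : ℝ) ^ L) ^ (n + 1) * (2 / 5) ^ (n * L) = (2 * (4 / 5) ^ n) ^ L := by
        rw [pow_mul, ← pow_mul, mul_comm L, pow_mul, ← mul_pow, pow_succ, mul_comm (2 ^ n),
          mul_assoc, ← mul_pow]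
        norm_num
    _ ≤ _ := pow_le_of_le_one (by positivity) h1 hL

/-- For a uniform matrix, a Gaussian preimage of a fixed vector is a short solution, up to a
probability exponentially small in `n` and `κ`. -/
theorem tsum_uniform_gaussianPreimage_le {n q : ℕ} [Fact q.Prime] (hq : 2 < q) (hn : 4 ≤ n)
    {σ : ℝ} (hσ : 1620 ≤ σ) (y : Fin n → ZMod q) (κ : ℕ) :
    ∑' A, PMF.uniformOfFintype (Matrix (Fin n) (GIdx n q) (ZMod q)) A *
        (gaussianPreimage A y σ).toOuterMeasure
          {x | A *ᵥ modVec q x ≠ y ∨ ¬ ∀ i, |(x i : ℝ)| ≤ √κ * σ}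
      ≤ ENNReal.ofReal (44 * (4 / 5) ^ n
          + (n * Nat.clog 2 q : ℕ) * (4 * Real.exp (-κ))) := by
  have hσ0 : 0 < σ := by linarith
  set S : Set (GIdx n q → ℤ) := {x | ¬ ∀ i, |(x i : ℝ)| ≤ √κ * σ} with hS
  set δ : ℝ := (2 / 5) ^ (n * Nat.clog 2 q) with hδ
  have hcard : Fintype.card (GIdx n q) = n * Nat.clog 2 q := by simp
  have h := sum_gaussianPreimage_toOuterMeasure_le (n := n) (q := q) (ι := GIdx n q) (δ := δ)
    (fun z => (gaussianVec_residue_le hq hσ z).trans_eq (by rw [hcard])) (by positivity) y S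
  have hS' : ((gaussianVec (GIdx n q) σ).toOuterMeasure S).toReal
      ≤ (n * Nat.clog 2 q : ℕ) * (2 * Real.exp (-κ)) :=
    ENNReal.toReal_le_of_le_ofReal (by positivity) (hcard ▸ gaussianVec_tail hσ0 κ)
  have hL : Nat.clog 2 q ≠ 0 := (Nat.clog_pos one_lt_two (by omega)).ne'
  obtain ⟨hD, hD1⟩ := pow_mul_two_fifths_pow_le hL hn
  rw [← hδ] at hD
  have hδ0 : 0 < δ := by positivity
  have hqL : (q : ℝ) ≤ 2 ^ Nat.clog 2 q := by exact_mod_cast Nat.le_pow_clog one_lt_two q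
  have hq2 : (2 : ℝ) ≤ q := by exact_mod_cast hq.le
  have hqn : (1 : ℝ) ≤ (q : ℝ) ^ n := one_le_pow₀ (by linarith)
  have hqD : (q : ℝ) * ((q : ℝ) ^ n * δ) ≤ 2 * (4 / 5) ^ n := by
    calc (q : ℝ) * ((q : ℝ) ^ n * δ) = (q : ℝ) ^ (n + 1) * δ := by ring
      _ ≤ (2 ^ Nat.clog 2 q) ^ (n + 1) * δ := by gcongr
      _ ≤ _ := hD
  set d : ℝ := (q : ℝ) ^ n * δ with hd
  have hd0 : 0 < d := by positivity
  have hδd : δ ≤ d := le_mul_of_one_le_left hδ0.le hqn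
  have hdq : d ≤ q * d := le_mul_of_one_le_left hd0.le (by linarith)
  have hdd : d ^ 2 ≤ q * d := by nlinarith
  -- Since `δ ≤ d ≤ q d ≤ 1`, the terms without `S` total at most `(4 + 4 + 4 + 8 + 2) q d = 22 q d
  -- ≤ 44 (4/5)ⁿ`.
  have hbound : 4 * (q + 1) * d + 4 * d ^ 2 + 8 * δ
      + 2 * ((gaussianVec (GIdx n q) σ).toOuterMeasure S).toReal + 2 * d
      ≤ 44 * (4 / 5) ^ n + (n * Nat.clog 2 q : ℕ) * (4 * Real.exp (-κ)) := by
    nlinarith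
  rw [tsum_fintype]
  have hN : (0 : ℝ) < Nat.card (Matrix (Fin n) (GIdx n q) (ZMod q)) := Nat.cast_pos.2 Nat.card_pos
  have e : ∀ A : Matrix (Fin n) (GIdx n q) (ZMod q),
      PMF.uniformOfFintype (Matrix (Fin n) (GIdx n q) (ZMod q)) A *
        (gaussianPreimage A y σ).toOuterMeasure {x | A *ᵥ modVec q x ≠ y ∨ x ∈ S}
      = ENNReal.ofReal ((Nat.card (Matrix (Fin n) (GIdx n q) (ZMod q)) : ℝ)⁻¹ *
        ((gaussianPreimage A y σ).toOuterMeasure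
          {x | A *ᵥ modVec q x ≠ y ∨ x ∈ S}).toReal) := by
    intro A
    rw [ENNReal.ofReal_mul (by positivity), ENNReal.ofReal_toReal (toOuterMeasure_ne_top _ _),
      PMF.uniformOfFintype_apply, ENNReal.ofReal_inv_of_pos hN, ENNReal.ofReal_natCast,
      Nat.card_eq_fintype_card]
  calc _ = ∑ A, ENNReal.ofReal ((Nat.card (Matrix (Fin n) (GIdx n q) (ZMod q)) : ℝ)⁻¹ *
        ((gaussianPreimage A y σ).toOuterMeasure
          {x | A *ᵥ modVec q x ≠ y ∨ x ∈ S}).toReal) := Finset.sum_congr rfl fun A _ => e A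
    _ = ENNReal.ofReal ((Nat.card (Matrix (Fin n) (GIdx n q) (ZMod q)) : ℝ)⁻¹ *
        ∑ A, ((gaussianPreimage A y σ).toOuterMeasure
          {x | A *ᵥ modVec q x ≠ y ∨ x ∈ S}).toReal) := by
        rw [Finset.mul_sum, ENNReal.ofReal_sum_of_nonneg fun A _ => by positivity]
    _ ≤ _ := by
        refine ENNReal.ofReal_le_ofReal ?_
        rw [inv_mul_le_iff₀ hN]
        exact h.trans (by gcongr)

/-- A key from the trapdoor sampler for a fixed vector is a short solution, up to a probability
exponentially small in `n` and `κ`. -/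
theorem TrapdoorSampler.toOuterMeasure_samplePre_le (T : TrapdoorSampler) {n q : ℕ} [Fact q.Prime]
    (hq : 2 < q) (hn : 4 ≤ n) {σ : ℝ} (hσ : 1620 ≤ σ)
    (h₁ : statDist ((T.trapGen n q).map Prod.fst)
      (PMF.uniformOfFintype (Matrix (Fin n) (GIdx n q) (ZMod q))) ≤ 2⁻¹ ^ n)
    (y : Fin n → ZMod q)
    (h₂ : statDist
        ((T.trapGen n q).bind fun a => (T.samplePre a.1 a.2 y σ).map fun x => (a, x))
        ((T.trapGen n q).bind fun a => (gaussianPreimage a.1 y σ).map fun x => (a, x)) ≤ 2⁻¹ ^ n)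
    (κ : ℕ) :
    ((T.trapGen n q).bind fun a => (T.samplePre a.1 a.2 y σ).map fun x => (a, x)).toOuterMeasure
        {w | w.1.1 *ᵥ modVec q w.2 ≠ y ∨ ¬ ∀ i, |(w.2 i : ℝ)| ≤ √κ * σ}
      ≤ ENNReal.ofReal (4 * 2⁻¹ ^ n + 44 * (4 / 5) ^ n
          + (n * Nat.clog 2 q : ℕ) * (4 * Real.exp (-κ))) := by
  set F : Matrix (Fin n) (GIdx n q) (ZMod q) → ℝ≥0∞ := fun A =>
    (gaussianPreimage A y σ).toOuterMeasure
      {x | A *ᵥ modVec q x ≠ y ∨ ¬ ∀ i, |(x i : ℝ)| ≤ √κ * σ} with hF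
  -- For exact preimages the bad event does not involve the trapdoor, so only the marginal law of
  -- `A` matters and it can be replaced by the uniform one. Two exchanges of distributions, each
  -- costing `2 · 2⁻ⁿ`, give the term `4 · 2⁻ⁿ`.
  have e : ((T.trapGen n q).bind fun a =>
        (gaussianPreimage a.1 y σ).map fun x => (a, x)).toOuterMeasure
        {w | w.1.1 *ᵥ modVec q w.2 ≠ y ∨ ¬ ∀ i, |(w.2 i : ℝ)| ≤ √κ * σ}
      = ∑' A, ((T.trapGen n q).map Prod.fst) A * F A := by
    have e1 : ∑' A, ((T.trapGen n q).map Prod.fst) A * F A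
        = (((T.trapGen n q).map Prod.fst).bind fun A =>
            (gaussianPreimage A y σ).map fun x => (A, x)).toOuterMeasure
          {w | w.1 *ᵥ modVec q w.2 ≠ y ∨ ¬ ∀ i, |(w.2 i : ℝ)| ≤ √κ * σ} := by
      rw [PMF.toOuterMeasure_bind_apply]
      simp only [PMF.toOuterMeasure_map_apply]
      rfl
    rw [e1, PMF.bind_map]
    simp only [PMF.toOuterMeasure_bind_apply, PMF.toOuterMeasure_map_apply, Function.comp_apply]
    rfl
  refine (toOuterMeasure_le_add_statDist _ _ _).trans
    ((add_le_add_left (e.trans_le (tsum_mul_le_add_statDist _ (PMF.uniformOfFintype _) F fun A =>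
      toOuterMeasure_le_one _ _)) _).trans ?_)
  have h3 := tsum_uniform_gaussianPreimage_le hq hn hσ y κ
  calc _ ≤ ENNReal.ofReal (44 * (4 / 5) ^ n + (n * Nat.clog 2 q : ℕ) * (4 * Real.exp (-κ)))
        + ENNReal.ofReal (2 * 2⁻¹ ^ n) + ENNReal.ofReal (2 * 2⁻¹ ^ n) := by gcongr
    _ = _ := by
      rw [← ENNReal.ofReal_add (by positivity) (by positivity),
        ← ENNReal.ofReal_add (by positivity) (by positivity)]
      congr 1
      ring

/-! ### Decryption -/

theorem sum_two_pow_testBit (x k : ℕ) :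
    ∑ b ∈ Finset.range k, 2 ^ b * (x.testBit b).toNat = x % 2 ^ k := by
  induction k with
  | zero => simp [Nat.mod_one]
  | succ k ih => rw [Finset.sum_range_succ, ih, Nat.mod_pow_succ, Nat.toNat_testBit]

theorem gadget_mulVec_gadgetInv {n q : ℕ} [NeZero q] (v : Fin n → ZMod q) :
    gadget n q *ᵥ gadgetInv v = v := by
  ext i
  have h : ∑ b : Fin (Nat.clog 2 q), 2 ^ (b : ℕ) * ((v i).val.testBit b).toNat = (v i).val := by
    rw [Fin.sum_univ_eq_sum_range (fun b => 2 ^ b * ((v i).val.testBit b).toNat),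
      sum_two_pow_testBit, Nat.mod_eq_of_lt]
    exact (ZMod.val_lt _).trans_le (Nat.le_pow_clog one_lt_two q)
  calc (gadget n q *ᵥ gadgetInv v) i
      = ∑ b : Fin (Nat.clog 2 q), (2 : ZMod q) ^ (b : ℕ) *
          (if (v i).val.testBit b then 1 else 0) := by
        simp only [Matrix.mulVec, dotProduct, gadget, gadgetInv, Fintype.sum_prod_type, ite_mul,
          zero_mul]
        rw [Finset.sum_eq_single i]
        · simp
        · intro j _ hj
          simp [hj.symm]
        · simp
    _ = ((∑ b : Fin (Nat.clog 2 q), 2 ^ (b : ℕ) * ((v i).val.testBit b).toNat : ℕ) : ZMod q) := by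
        push_cast
        refine Finset.sum_congr rfl fun b _ => ?_
        cases (v i).val.testBit b <;> simp
    _ = v i := by rw [h, ZMod.natCast_zmod_val]

theorem modVec_dotProduct {ι : Type*} [Fintype ι] (q : ℕ) (x y : ι → ℤ) :
    modVec q x ⬝ᵥ modVec q y = ((x ⬝ᵥ y : ℤ) : ZMod q) := by
  simp [modVec, dotProduct]

theorem abs_dotProduct_le {ι : Type*} [Fintype ι] {x y : ι → ℤ} {a b : ℝ} (ha : 0 ≤ a)
    (hx : ∀ i, |(x i : ℝ)| ≤ a) (hy : ∀ i, |(y i : ℝ)| ≤ b) :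
    |((x ⬝ᵥ y : ℤ) : ℝ)| ≤ Fintype.card ι * (a * b) := by
  simp only [dotProduct, Int.cast_sum, Int.cast_mul]
  refine (Finset.abs_sum_le_sum_abs _ _).trans ?_
  calc _ ≤ ∑ _i : ι, a * b := by
        refine Finset.sum_le_sum fun i _ => ?_
        rw [abs_mul]
        exact mul_le_mul (hx i) (hy i) (abs_nonneg _) ha
    _ = _ := by simp

/-- The binary digits of the entries of `v`, as integers. -/
def gadgetDigits {n q : ℕ} (v : Fin n → ZMod q) : GIdx n q → ℤ :=
  fun p => if (v p.1).val.testBit p.2 then 1 else 0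

theorem modVec_gadgetDigits {n q : ℕ} (v : Fin n → ZMod q) :
    modVec q (gadgetDigits v) = gadgetInv v := by
  ext p
  simp only [modVec, gadgetDigits, gadgetInv]
  split_ifs <;> simp

theorem abs_gadgetDigits_le {n q : ℕ} (v : Fin n → ZMod q) (p : GIdx n q) :
    |(gadgetDigits v p : ℝ)| ≤ 1 := by
  rw [gadgetDigits]
  split_ifs <;> simp

/-- Decryption returns the inner product plus a small error if the keys are short solutions and the
errors and the value of the random oracle are short. -/
theorem exists_decryption_error {n q m' : ℕ} [NeZero q] {J : Type*} [Fintype J]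
    (u v : Fin n → ZMod q) (pk : J → PubKey n q m') (s : J → Fin n → ZMod q)
    (k e₁ : J → GIdx n q → ℤ) (e₂ h : Fin m' → ℤ) (e₃ : GIdx n q → ℤ) {a b : ℝ} (ha : 0 ≤ a)
    (hk : ∀ j, (pk j).A *ᵥ modVec q (k j) = (pk j).P *ᵥ gadgetInv v + (pk j).B *ᵥ modVec q h)
    (hk' : ∀ j i, |(k j i : ℝ)| ≤ a) (he₁ : ∀ j i, |(e₁ j i : ℝ)| ≤ a)
    (he₂ : ∀ i, |(e₂ i : ℝ)| ≤ a) (he₃ : ∀ i, |(e₃ i : ℝ)| ≤ a) (hh : ∀ i, |(h i : ℝ)| ≤ b) :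
    ∃ e₀ : ℤ,
      |(e₀ : ℝ)| ≤ (n * Nat.clog 2 q : ℕ) * a + m' * (a * b)
        + Fintype.card J * ((n * Nat.clog 2 q : ℕ) * (a * a)) ∧
      (∑ j, s j ᵥ* (pk j).P + modVec q e₃ + u ᵥ* gadget n q) ⬝ᵥ gadgetInv v
        + (∑ j, s j ᵥ* (pk j).B + modVec q e₂) ⬝ᵥ modVec q h
        - ∑ j, (s j ᵥ* (pk j).A + modVec q (e₁ j)) ⬝ᵥ modVec q (k j)
      = u ⬝ᵥ v + (e₀ : ZMod q) := by
  have hcard : Fintype.card (GIdx n q) = n * Nat.clog 2 q := by simp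
  -- The error is formed over `ℤ` from short lifts, so its size makes sense before reduction modulo
  -- `q`.
  refine ⟨e₃ ⬝ᵥ gadgetDigits v + e₂ ⬝ᵥ h - ∑ j, e₁ j ⬝ᵥ k j, ?_, ?_⟩
  · have h1 := abs_dotProduct_le ha he₃ (abs_gadgetDigits_le v)
    have h2 := abs_dotProduct_le ha he₂ hh
    have h3 : |((∑ j, e₁ j ⬝ᵥ k j : ℤ) : ℝ)|
        ≤ Fintype.card J * ((n * Nat.clog 2 q : ℕ) * (a * a)) := by
      rw [Int.cast_sum]
      refine (Finset.abs_sum_le_sum_abs _ _).trans ?_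
      calc _ ≤ ∑ _j : J, ((n * Nat.clog 2 q : ℕ) : ℝ) * (a * a) := by
            refine Finset.sum_le_sum fun j _ => ?_
            rw [← hcard]
            exact abs_dotProduct_le ha (he₁ j) (hk' j)
        _ = _ := by simp
    rw [hcard, mul_one] at h1
    rw [Fintype.card_fin] at h2
    rw [Int.cast_sub, Int.cast_add]
    exact (abs_sub _ _).trans (add_le_add ((abs_add_le _ _).trans (add_le_add h1 h2)) h3)
  · simp only [add_dotProduct, sum_dotProduct, ← Matrix.dotProduct_mulVec, hk,
      gadget_mulVec_gadgetInv, dotProduct_add, Finset.sum_add_distrib, modVec_dotProduct]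
    rw [← modVec_gadgetDigits v, modVec_dotProduct]
    push_cast
    ring

/-! ### The correctness experiment -/

/-- Isolates one authority: its setup output and key have the same joint law as if it were alone. -/
theorem toOuterMeasure_indep_bind_indep {ι α β : Type*} [Fintype ι] (p : ι → PMF α)
    (r : ι → α → PMF β) (i : ι) (S : Set (α × β)) :
    ((indep p).bind fun k => (indep fun j => r j (k j)).map fun s => (k, s)).toOuterMeasure
        {w | (w.1 i, w.2 i) ∈ S}
      = ((p i).bind fun k => (r i k).map fun s => (k, s)).toOuterMeasure S := by
  rw [← indep_bind_eval p i fun k => (r i k).map fun s => (k, s)]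
  simp only [PMF.toOuterMeasure_bind_apply, PMF.toOuterMeasure_map_apply]
  refine tsum_congr fun k => ?_
  congr 1
  exact toOuterMeasure_indep_eval (fun j => r j (k j)) i {s | (k i, s) ∈ S}

section

variable (T : TrapdoorSampler) {n q m' : ℕ} [Fact q.Prime] {χ χ' : ℝ} {AU GID : Type}
  [DecidableEq AU] [Fintype GID]

/-- The key `w.2` issued under the public key and master secret key `w.1` is not a short solution
for the value `H` of the random oracle. -/
def badKey {n q m' : ℕ} {TD : Type} (H : Fin m' → ZMod q) (v : Fin n → ZMod q) (a : ℝ) :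
    Set ((PubKey n q m' × TD) × (GIdx n q → ℤ)) :=
  {w | w.1.1.A *ᵥ modVec q w.2 ≠ w.1.1.P *ᵥ gadgetInv v + w.1.1.B *ᵥ H
    ∨ ¬ ∀ i, |(w.2 i : ℝ)| ≤ a}

theorem construction_badKey_le {N : ℕ} {χ₀ : ℕ → ℕ → ℝ}
    (hT : ∀ (n q : ℕ) [Fact q.Prime], N ≤ n → 2 < q →
      statDist ((T.trapGen n q).map Prod.fst)
        (PMF.uniformOfFintype (Matrix (Fin n) (GIdx n q) (ZMod q))) ≤ 2⁻¹ ^ n ∧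
      ∀ σ : ℝ, 0 < σ → χ₀ n q ≤ σ → ∀ y : Fin n → ZMod q,
        statDist
          ((T.trapGen n q).bind fun a => (T.samplePre a.1 a.2 y σ).map fun x => (a, x))
          ((T.trapGen n q).bind fun a => (gaussianPreimage a.1 y σ).map fun x => (a, x))
            ≤ 2⁻¹ ^ n)
    (hN : N ≤ n) (hn : 4 ≤ n) (hq : 2 < q) (hχ : 1620 ≤ χ) (hχ₀ : χ₀ n q ≤ χ) (κ : ℕ)
    (H : GID × (Fin n → ZMod q) → Fin m' → ZMod q) (aid : AU) (gid : GID) (v : Fin n → ZMod q) :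
    (((construction T n q m' χ χ' AU GID).authSetup H aid).bind fun k =>
        ((construction T n q m' χ χ' AU GID).keygen H k.1 k.2 gid v).map fun s =>
          (k, s)).toOuterMeasure (badKey (H (gid, v)) v (√κ * χ))
      ≤ ENNReal.ofReal (4 * 2⁻¹ ^ n + 44 * (4 / 5) ^ n
          + (n * Nat.clog 2 q : ℕ) * (4 * Real.exp (-κ))) := by
  obtain ⟨h1, h2⟩ := hT n q hN hq
  have hχ0 : 0 < χ := by linarith
  simp only [construction, PMF.bind_bind, PMF.bind_map]
  -- `B` and `P` are drawn independently of `(A, td)`, so they can be fixed first. The target `P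
  -- G⁻¹(v) + B H` is then a constant, as the guarantee on the sampler requires.
  rw [PMF.bind_comm]
  refine toOuterMeasure_bind_le_of_forall fun B => ?_
  rw [PMF.bind_comm]
  refine toOuterMeasure_bind_le_of_forall fun P => ?_
  have h3 := T.toOuterMeasure_samplePre_le hq hn hχ h1 (P *ᵥ gadgetInv v + B *ᵥ H (gid, v))
    (h2 χ hχ0 hχ₀ _) κ
  refine le_trans (le_of_eq ?_) h3
  simp only [PMF.toOuterMeasure_bind_apply, PMF.toOuterMeasure_map_apply, Function.comp_apply]
  rfl

theorem construction_enc_dec_le (hχ : 0 < χ) (κ : ℕ) (H : GID × (Fin n → ZMod q) → Fin m' → ZMod q)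
    (X Y : Finset AU) (hY : Y ∈ subsetPolicy X) (pk : Y → PubKey n q m')
    (sk : Y → GIdx n q → ℤ) (u v : Fin n → ZMod q) (gid : GID) {h : Fin m' → ℤ} {b : ℝ}
    (hH : modVec q h = H (gid, v)) (hh : ∀ i, |(h i : ℝ)| ≤ b)
    (hk : ∀ aid ∈ X.attach, (pk ⟨aid, hY aid.2⟩).A *ᵥ modVec q (sk ⟨aid, hY aid.2⟩)
      = (pk ⟨aid, hY aid.2⟩).P *ᵥ gadgetInv v + (pk ⟨aid, hY aid.2⟩).B *ᵥ H (gid, v))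
    (hk' : ∀ aid ∈ X.attach, ∀ i, |(sk ⟨aid, hY aid.2⟩ i : ℝ)| ≤ √κ * χ) {B₀ : ℝ}
    (hB₀ : (n * Nat.clog 2 q : ℕ) * (√κ * χ) + m' * (√κ * χ * b)
        + X.card * ((n * Nat.clog 2 q : ℕ) * (√κ * χ * (√κ * χ))) ≤ B₀) :
    (((construction T n q m' χ χ' AU GID).enc H X (fun aid => pk ⟨aid, hY aid.2⟩) u).bind
        fun ct => (construction T n q m' χ χ' AU GID).dec H Y sk gid v ct).toOuterMeasure
        {Γ | ∃ e₀ : ℤ, |(e₀ : ℝ)| ≤ B₀ ∧ Γ = some (u ⬝ᵥ v + (e₀ : ZMod q))}ᶜ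
      ≤ X.card * ENNReal.ofReal ((n * Nat.clog 2 q : ℕ) * (2 * Real.exp (-κ)))
        + (ENNReal.ofReal (m' * (2 * Real.exp (-κ)))
          + ENNReal.ofReal ((n * Nat.clog 2 q : ℕ) * (2 * Real.exp (-κ)))) := by
  have hcard : Fintype.card (GIdx n q) = n * Nat.clog 2 q := by simp
  have hg := gaussianVec_tail (ι := GIdx n q) hχ κ
  rw [hcard] at hg
  have hg' := gaussianVec_tail (ι := Fin m') hχ κ
  rw [Fintype.card_fin] at hg'
  simp only [construction, PMF.bind_bind, PMF.bind_map]
  refine toOuterMeasure_bind_le_of_forall fun s => ?_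
  have hg₁ := toOuterMeasure_indep_exists_le (fun _ : X => gaussianVec (GIdx n q) χ) _ fun _ => hg
  rw [Fintype.card_coe] at hg₁
  refine toOuterMeasure_bind_le hg₁ fun e₁ he₁ => ?_
  refine toOuterMeasure_bind_le hg' fun e₂ he₂ => ?_
  -- Once all errors are short, decryption succeeds with certainty, so the last conditional failure
  -- probability is 0.
  rw [← add_zero (ENNReal.ofReal _)]
  refine toOuterMeasure_bind_le hg fun e₃ he₃ => ?_
  obtain ⟨e₀, he₀, he⟩ := exists_decryption_error u v (fun j : X => pk ⟨j, hY j.2⟩) s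
    (fun j : X => sk ⟨j, hY j.2⟩) e₁ e₂ h e₃ (a := √κ * χ) (b := b) (by positivity)
    (fun j => hH ▸ hk j (Finset.mem_attach _ _)) (fun j => hk' j (Finset.mem_attach _ _))
    (fun j i => by by_contra hc; exact he₁ ⟨j, fun hc' => hc (hc' i)⟩)
    (not_not.1 he₂) (not_not.1 he₃) hh
  rw [Fintype.card_coe] at he₀
  have hY' : X ⊆ Y := hY
  simp only [Function.comp_apply, hY', dif_pos, PMF.toOuterMeasure_pure_apply]
  rw [if_neg]
  rw [Set.mem_compl_iff, not_not]
  exact ⟨e₀, he₀.trans hB₀, by rw [← he, hH]⟩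

theorem construction_experiment_le {N : ℕ} {χ₀ : ℕ → ℕ → ℝ}
    (hT : ∀ (n q : ℕ) [Fact q.Prime], N ≤ n → 2 < q →
      statDist ((T.trapGen n q).map Prod.fst)
        (PMF.uniformOfFintype (Matrix (Fin n) (GIdx n q) (ZMod q))) ≤ 2⁻¹ ^ n ∧
      ∀ σ : ℝ, 0 < σ → χ₀ n q ≤ σ → ∀ y : Fin n → ZMod q,
        statDist
          ((T.trapGen n q).bind fun a => (T.samplePre a.1 a.2 y σ).map fun x => (a, x))
          ((T.trapGen n q).bind fun a => (gaussianPreimage a.1 y σ).map fun x => (a, x))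
            ≤ 2⁻¹ ^ n)
    (hN : N ≤ n) (hn : 4 ≤ n) (hq : 2 < q) (hχ : 1620 ≤ χ) (hχ' : 0 < χ') (hχ₀ : χ₀ n q ≤ χ)
    (κ : ℕ) (u v : Fin n → ZMod q) (gid : GID) (X Y : Finset AU) (hY : Y ∈ subsetPolicy X)
    {B₀ : ℝ}
    (hB₀ : (n * Nat.clog 2 q : ℕ) * (√κ * χ) + m' * (√κ * χ * (√κ * χ'))
        + X.card * ((n * Nat.clog 2 q : ℕ) * (√κ * χ * (√κ * χ))) ≤ B₀) :
    ((construction T n q m' χ χ' AU GID).experiment u v gid X Y hY).toOuterMeasure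
        {Γ | ∃ e₀ : ℤ, |(e₀ : ℝ)| ≤ B₀ ∧ Γ = some (u ⬝ᵥ v + (e₀ : ZMod q))}ᶜ
      ≤ ENNReal.ofReal (m' * (2 * Real.exp (-κ)))
        + (X.card * ENNReal.ofReal (4 * 2⁻¹ ^ n + 44 * (4 / 5) ^ n
            + (n * Nat.clog 2 q : ℕ) * (4 * Real.exp (-κ)))
          + (X.card * ENNReal.ofReal ((n * Nat.clog 2 q : ℕ) * (2 * Real.exp (-κ)))
            + (ENNReal.ofReal (m' * (2 * Real.exp (-κ)))
              + ENNReal.ofReal ((n * Nat.clog 2 q : ℕ) * (2 * Real.exp (-κ)))))) := by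
  have hχ0 : 0 < χ := by linarith
  set S := construction T n q m' χ χ' AU GID with hS
  -- Only the oracle value at `(gid, v)` matters; it is good if it has a short integer lift.
  have hH : (S.globalSetup).toOuterMeasure
      {H : GID × (Fin n → ZMod q) → Fin m' → ZMod q |
        H (gid, v) ∈ {h | ¬ ∃ x, modVec q x = h ∧ ∀ i, |(x i : ℝ)| ≤ √κ * χ'}}
      ≤ ENNReal.ofReal (m' * (2 * Real.exp (-κ))) := by
    refine (toOuterMeasure_indep_eval (fun _ : GID × (Fin n → ZMod q) =>
      (gaussianVec (Fin m') χ').map (modVec q)) (gid, v) _).trans_le ?_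
    rw [PMF.toOuterMeasure_map_apply]
    have h := gaussianVec_tail (ι := Fin m') hχ' κ
    rw [Fintype.card_fin] at h
    refine le_trans (MeasureTheory.measure_mono ?_) h
    intro x hx hx'
    exact hx ⟨x, rfl, hx'⟩
  refine toOuterMeasure_bind_le hH fun H hHgood => ?_
  obtain ⟨h, hh, hh'⟩ := not_not.1 hHgood
  have e : ((indep fun aid : Y => S.authSetup H aid).bind fun keys =>
      (indep fun aid : Y => S.keygen H (keys aid).1 (keys aid).2 gid v).bind fun sk =>
      (S.enc H X (fun aid => (keys ⟨aid, hY aid.2⟩).1) u).bind fun ct => S.dec H Y sk gid v ct)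
      = ((indep fun aid : Y => S.authSetup H aid).bind fun keys =>
        (indep fun aid : Y => S.keygen H (keys aid).1 (keys aid).2 gid v).map fun sk =>
          (keys, sk)).bind fun w =>
        (S.enc H X (fun aid => (w.1 ⟨aid, hY aid.2⟩).1) u).bind fun ct =>
          S.dec H Y w.2 gid v ct := by
    simp only [PMF.bind_bind, PMF.bind_map]
    rfl
  rw [e]
  -- The union bound runs over `X` and not `Y`: the size of `Y` is not bounded by `ℓ`, and
  -- decryption only uses the keys of `X`.
  have hkeys := toOuterMeasure_exists_le X.attach
    ((indep fun aid : Y => S.authSetup H aid).bind fun keys =>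
      (indep fun aid : Y => S.keygen H (keys aid).1 (keys aid).2 gid v).map fun sk => (keys, sk))
    (fun aid => {w | (w.1 ⟨aid, hY aid.2⟩, w.2 ⟨aid, hY aid.2⟩)
      ∈ badKey (H (gid, v)) v (√κ * χ)})
    fun aid _ => (toOuterMeasure_indep_bind_indep (fun aid : Y => S.authSetup H aid)
      (fun _ k => S.keygen H k.1 k.2 gid v) ⟨aid, hY aid.2⟩ _).trans_le
      (construction_badKey_le (χ' := χ') T hT hN hn hq hχ hχ₀ κ H aid.1 gid v)
  rw [Finset.card_attach] at hkeys
  refine toOuterMeasure_bind_le hkeys fun w hw => ?_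
  have hw' : ∀ aid ∈ X.attach, (w.1 ⟨aid, hY aid.2⟩, w.2 ⟨aid, hY aid.2⟩)
      ∉ badKey (H (gid, v)) v (√κ * χ) := fun aid ha hb => hw ⟨aid, ha, hb⟩
  exact construction_enc_dec_le T hχ0 κ H X Y hY (fun aid => (w.1 aid).1) w.2 u v gid hh hh'
    (fun aid ha => by by_contra hc; exact hw' aid ha (Or.inl hc))
    (fun aid ha => by by_contra hc; exact hw' aid ha (Or.inr hc)) hB₀

end

/-! ### Asymptotics -/

theorem Negligible.add {f g : ℕ → ℝ} (hf : Negligible f) (hg : Negligible g) :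
    Negligible fun κ => f κ + g κ := fun c hc => (hf c hc).add (hg c hc)

theorem Negligible.const_mul {f : ℕ → ℝ} (hf : Negligible f) (a : ℝ) :
    Negligible fun κ => a * f κ := fun c hc => (hf c hc).const_mul_left a

theorem Negligible.congr' {f g : ℕ → ℝ} (hf : Negligible f) (h : f =ᶠ[atTop] g) :
    Negligible g := fun c hc => (hf c hc).congr' h EventuallyEq.rfl

theorem PolyBounded.mul_negligible {f g : ℕ → ℝ} (hf : PolyBounded f) (hg : Negligible g) :
    Negligible fun κ => f κ * g κ := by
  obtain ⟨c, hc, hf⟩ := hf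
  refine fun d hd => (hf.mul (hg (c + d) (by positivity))).congr' EventuallyEq.rfl ?_
  filter_upwards [eventually_gt_atTop 0] with κ hκ
  rw [← Real.rpow_add (Nat.cast_pos.2 hκ)]
  congr 1
  ring

theorem negligible_exp_neg : Negligible fun κ => Real.exp (-κ) := by
  intro c _
  have h := (isLittleO_exp_neg_mul_rpow_atTop one_pos (-c)).isBigO.comp_tendsto
    tendsto_natCast_atTop_atTop
  simpa [Function.comp_def] using h

/-- Fourth roots preserve negligibility. Needed because `(4/5)⁴ ≤ 1/2` bounds the fourth power of
`(4/5)ⁿ` by `2⁻ⁿ`. -/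
theorem Negligible.of_pow_four_le {f g : ℕ → ℝ} (hf : Negligible f) (hg : ∀ κ, 0 ≤ g κ)
    (h : ∀ κ, g κ ^ 4 ≤ f κ) : Negligible g := by
  intro c hc
  obtain ⟨C, hC, hb⟩ := (hf (c * 4) (by positivity)).exists_pos
  refine IsBigO.of_bound (C + 1) ?_
  filter_upwards [hb.bound, eventually_gt_atTop 0] with κ h1 hκ
  have hκ' : (0 : ℝ) < κ := Nat.cast_pos.2 hκ
  have hpos : 0 < (κ : ℝ) ^ (-c) := Real.rpow_pos_of_pos hκ' _
  have e : (κ : ℝ) ^ (-(c * 4)) = ((κ : ℝ) ^ (-c)) ^ 4 := by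
    rw [← Real.rpow_natCast, ← Real.rpow_mul hκ'.le]
    congr 1
    push_cast
    ring
  rw [e, Real.norm_of_nonneg ((pow_nonneg (hg κ) 4).trans (h κ)),
    Real.norm_of_nonneg (by positivity)] at h1
  rw [Real.norm_of_nonneg (hg κ), Real.norm_of_nonneg hpos.le]
  refine le_of_pow_le_pow_left₀ four_ne_zero (by positivity) (((h κ).trans h1).trans ?_)
  rw [mul_pow]
  gcongr
  calc C ≤ C + 1 := by linarith
    _ ≤ (C + 1) ^ 4 := le_self_pow₀ (by linarith) four_ne_zero

theorem Negligible.four_fifths_pow {n : ℕ → ℕ} (hn : Negligible fun κ => 2⁻¹ ^ n κ) :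
    Negligible fun κ => (4 / 5) ^ n κ := by
  refine hn.of_pow_four_le (fun κ => by positivity) fun κ => ?_
  rw [← pow_mul, mul_comm, pow_mul]
  exact pow_le_pow_left₀ (by norm_num) (by norm_num) _

theorem Negligible.eventually_le {n : ℕ → ℕ} (hn : Negligible fun κ => 2⁻¹ ^ n κ) (M : ℕ) :
    ∀ᶠ κ in atTop, M ≤ n κ := by
  have h0 : Tendsto (fun κ : ℕ => (2⁻¹ : ℝ) ^ n κ) atTop (nhds 0) :=
    (hn 1 one_pos).trans_tendsto
      ((tendsto_rpow_neg_atTop one_pos).comp tendsto_natCast_atTop_atTop)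
  filter_upwards [h0.eventually_lt_const (show (0 : ℝ) < 2⁻¹ ^ M by positivity)] with κ hκ
  exact ((pow_lt_pow_iff_right_of_lt_one₀ (by norm_num) (by norm_num)).1 hκ).le

/-- For `n ≥ 3 > e` one has `√(log n) ≥ 1`, so `f n ≥ 1` eventually; the other factor is at least
`√n` because `log₂ q ≥ 1`. -/
theorem IsWidthThreshold.exists_le {χ₀ : ℕ → ℕ → ℝ} (h : IsWidthThreshold χ₀) (C : ℕ) :
    ∃ N : ℕ, ∀ n q : ℕ, N ≤ n → 2 < q → C ≤ χ₀ n q := by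
  obtain ⟨f, hf, hχ⟩ := h
  obtain ⟨N, hN⟩ := eventually_atTop.1 (hf.eventually_ge_atTop 1)
  refine ⟨max N (max 3 (C ^ 2)), fun n q hn hq => le_trans ?_ (hχ n q hq)⟩
  simp only [max_le_iff] at hn
  obtain ⟨hn, hn3, hnC⟩ := hn
  have hlog : 1 ≤ √(Real.log n) := by
    rw [Real.one_le_sqrt, Real.le_log_iff_exp_le (by positivity)]
    exact Real.exp_one_lt_three.le.trans (by exact_mod_cast hn3)
  have hfn : 1 ≤ f n := by
    have := hN n hn
    rw [le_div_iff₀ (by linarith)] at this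
    linarith
  have hlogb : 1 ≤ Real.logb 2 q := by
    rw [Real.le_logb_iff_rpow_le one_lt_two (by positivity), Real.rpow_one]
    exact_mod_cast hq.le
  have hs : (C : ℝ) ≤ √(n * Real.logb 2 q) := by
    refine Real.le_sqrt_of_sq_le ?_
    calc (C : ℝ) ^ 2 ≤ n := by exact_mod_cast hnC
      _ ≤ n * Real.logb 2 q := le_mul_of_one_le_right (Nat.cast_nonneg n) hlogb
  exact hs.trans (le_mul_of_one_le_right (Real.sqrt_nonneg _) hfn)

end MAABNIPFE

/-! ### Approximate correctness -/

theorem mainTheorem5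
    (χ₀ : ℕ → ℕ → ℝ) (hχ₀ : MAABNIPFE.IsWidthThreshold χ₀)
    (T : MAABNIPFE.TrapdoorSampler) (hT : T.Implements χ₀)
    (n q m' ℓ : ℕ → ℕ) (χ χ' : ℕ → ℝ)
    [hq : ∀ κ, Fact (q κ).Prime] (hq2 : ∀ κ, 2 < q κ)
    (hn : MAABNIPFE.Negligible fun κ => 2⁻¹ ^ n κ)
    (hm : MAABNIPFE.PolyBounded fun κ => n κ * Nat.clog 2 (q κ))
    (hm' : MAABNIPFE.PolyBounded fun κ => m' κ)
    (hℓ : MAABNIPFE.PolyBounded fun κ => ℓ κ)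
    (hχ : ∀ κ, 0 < χ κ) (hχ' : ∀ κ, 0 < χ' κ)
    (hχχ₀ : ∀ κ, χ₀ (n κ) (q κ) ≤ χ κ) :
    MAABNIPFE.ApproxCorrect
      (fun κ => MAABNIPFE.construction T (n κ) (q κ) (m' κ) (χ κ) (χ' κ)
        (Fin κ → Bool) (Fin κ → Bool))
      ℓ
      (fun κ =>
        √κ * χ κ * (n κ * Nat.clog 2 (q κ) : ℕ)
          + κ * χ κ * χ' κ * m' κ
          + κ * χ κ ^ 2 * (n κ * Nat.clog 2 (q κ) : ℕ) * ℓ κ) := by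
  classical
  obtain ⟨N, hN⟩ := hT
  obtain ⟨N', hN'⟩ := hχ₀.exists_le 1620
  obtain ⟨K, hK⟩ := eventually_atTop.1 (hn.eventually_le (max N (max N' 4)))
  set m : ℕ → ℕ := fun κ => n κ * Nat.clog 2 (q κ) with hmdef
  have hm₁ : MAABNIPFE.PolyBounded fun κ => (m κ : ℝ) := by simpa [hmdef] using hm
  set g : ℕ → ℝ := fun κ => 4 * (m' κ * Real.exp (-κ)) + 2 * (m κ * Real.exp (-κ))
    + ℓ κ * (4 * 2⁻¹ ^ n κ + 44 * (4 / 5) ^ n κ + 6 * (m κ * Real.exp (-κ))) with hg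
  have hexp := MAABNIPFE.negligible_exp_neg
  have hg' : MAABNIPFE.Negligible g :=
    (((hm'.mul_negligible hexp).const_mul 4).add ((hm₁.mul_negligible hexp).const_mul 2)).add
      (hℓ.mul_negligible (((hn.const_mul 4).add (hn.four_fifths_pow.const_mul 44)).add
        ((hm₁.mul_negligible hexp).const_mul 6)))
  -- Below `K` the value 1 makes the claim trivial, and finitely many values do not affect
  -- negligibility.
  refine ⟨fun κ => if κ < K then 1 else g κ, hg'.congr' ?_, fun κ u v gid X hX Y hY => ?_⟩
  · filter_upwards [eventually_ge_atTop K] with κ hκ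
    rw [if_neg (not_lt.2 hκ)]
  · dsimp only
    split_ifs with hκ
    · rw [sub_self]
      exact ENNReal.toReal_nonneg
    · have hn₀ := hK κ (not_lt.1 hκ)
      simp only [max_le_iff] at hn₀
      have hX' : (X.card : ℝ) ≤ ℓ κ := Nat.cast_le.2 hX
      have hχκ := hχ κ
      have hχκ' := hχ' κ
      have hsq : √(κ : ℝ) * √κ = κ := Real.mul_self_sqrt (Nat.cast_nonneg κ)
      have hfail := MAABNIPFE.construction_experiment_le T (m' := m' κ) hN hn₀.1 hn₀.2.2 (hq2 κ)
        ((hN' _ _ hn₀.2.1 (hq2 κ)).trans (hχχ₀ κ)) hχκ' (hχχ₀ κ) κ u v gid X Y hY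
        (B₀ := √κ * χ κ * (n κ * Nat.clog 2 (q κ) : ℕ) + κ * χ κ * χ' κ * m' κ
          + κ * χ κ ^ 2 * (n κ * Nat.clog 2 (q κ) : ℕ) * ℓ κ) (by
          calc _ = √κ * χ κ * (n κ * Nat.clog 2 (q κ) : ℕ) + √κ * √κ * χ κ * χ' κ * m' κ
                + √κ * √κ * χ κ ^ 2 * (n κ * Nat.clog 2 (q κ) : ℕ) * X.card := by ring
            _ ≤ _ := by rw [hsq]; gcongr)
      have hbound : ENNReal.ofReal (m' κ * (2 * Real.exp (-κ)))
          + (X.card * ENNReal.ofReal (4 * 2⁻¹ ^ n κ + 44 * (4 / 5) ^ n κ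
              + (n κ * Nat.clog 2 (q κ) : ℕ) * (4 * Real.exp (-κ)))
            + (X.card * ENNReal.ofReal ((n κ * Nat.clog 2 (q κ) : ℕ) * (2 * Real.exp (-κ)))
              + (ENNReal.ofReal (m' κ * (2 * Real.exp (-κ)))
                + ENNReal.ofReal ((n κ * Nat.clog 2 (q κ) : ℕ) * (2 * Real.exp (-κ))))))
          ≤ ENNReal.ofReal (g κ) := by
        rw [← ENNReal.ofReal_natCast X.card, ← ENNReal.ofReal_mul (by positivity),
          ← ENNReal.ofReal_mul (by positivity), ← ENNReal.ofReal_add (by positivity) (by positivity),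
          ← ENNReal.ofReal_add (by positivity) (by positivity),
          ← ENNReal.ofReal_add (by positivity) (by positivity),
          ← ENNReal.ofReal_add (by positivity) (by positivity)]
        refine ENNReal.ofReal_le_ofReal ?_
        calc _ = 4 * (m' κ * Real.exp (-κ)) + 2 * (m κ * Real.exp (-κ)) + X.card *
              (4 * 2⁻¹ ^ n κ + 44 * (4 / 5) ^ n κ + 6 * (m κ * Real.exp (-κ))) := by ring
          _ ≤ _ := by simp only [hg]; gcongr
      have hg0 : 0 ≤ g κ := by positivity
      have hle := ENNReal.toReal_le_of_le_ofReal hg0 (hfail.trans hbound)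
      have htot := congrArg ENNReal.toReal (MAABNIPFE.toOuterMeasure_add_compl
        ((MAABNIPFE.construction T (n κ) (q κ) (m' κ) (χ κ) (χ' κ)
          (Fin κ → Bool) (Fin κ → Bool)).experiment u v gid X Y hY)
        {Γ | ∃ e₀ : ℤ, |(e₀ : ℝ)| ≤ √κ * χ κ * (n κ * Nat.clog 2 (q κ) : ℕ)
          + κ * χ κ * χ' κ * m' κ + κ * χ κ ^ 2 * (n κ * Nat.clog 2 (q κ) : ℕ) * ℓ κ
          ∧ Γ = some (u ⬝ᵥ v + (e₀ : ZMod (q κ)))})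
      rw [ENNReal.toReal_add (MAABNIPFE.toOuterMeasure_ne_top _ _)
        (MAABNIPFE.toOuterMeasure_ne_top _ _), ENNReal.toReal_one] at htot
      linarith
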